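/- Let $n\ge 1$, $p>0$, $0<\rho<1$. For $R,T>0$ let $\Omega=B_R\times(-T,0)\subset\mathbb R^n\times\mathbb R$, where $B_R$ is the open ball of radius $R$ about the origin, and let $\rho\Omega=\{\rho X: X\in\Omega\}=B_{\rho R}\times(-\rho T,0)$. Consider $$Lu=-u_t+\sum_{i,j}a^{ij}D_{ij}u+\sum_i b^iD_iu+cu$$ with real-valued bounded measurable coefficients on $\Omega$ and $(a^{ij})$ symmetric. Assume that there are constants $\lambda_0>0$, $\Lambda_0$, $B$ and $c_0\ge 0$ such that on $\Omega$ all eigenvalues of $(a^{ij})$ lie in $[\lambda_0,\Lambda_0]$, $|b|\le B$ and $c\le c_0$. Let $f$ be a real-valued measurable function on $\Omega$ and let $u\in W^{2,1}_{n+1,\mathrm{loc}}(\Omega)\cap C^0(\overline\Omega)$ (that is, the weak derivatives $u_t$, $D_iu$, $D_{ij}u$ exist and, like $u$, belong to $L^{n+1}_{\mathrm{loc}}(\Omega)$) satisfy $Lu\ge f$ almost everywhere in $\Omega$. Then $$\sup_{\rho\Omega}u\le C\left(|\Omega|^{-1/p}\,\|u^+\|_{L^p(\Omega)}+(TR^{-1})^{\frac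 n{n+1}}\,\|f\|_{L^{n+1}(\Omega)}\right),$$ where $u^+=\max(u,0)$, $\|u^+\|_{L^p(\Omega)}=\left(\int_\Omega (u^+)^p\right)^{1/p}$ also for $p<1$, the right-hand side may be $+\infty$, and the constant $C$ depends only on $n$, $p$, $\rho$ and the scale-invariant quantity $$(\lambda_0^{-n}TR^{-2})^{\frac1{n+1}}\left(c_0R^2+BR+\Lambda_0+R^2T^{-1}\right).$$ -/

import Mathlib

open MeasureTheory
open scoped ENNReal ContDiff Pointwise

/-- Space-time `ℝⁿ × ℝ`, with points `X = (x, t)`, the Euclidean norm on `ℝⁿ` and Lebesgue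
measure `volume`. -/
abbrev SpaceTime (n : ℕ) : Type := EuclideanSpace ℝ (Fin n) × ℝ

/-- The open cylinder `B_R × (-T, 0)`, where `B_R` is the open ball of radius `R` around `0`. -/
def parabolicCylinder (n : ℕ) (R T : ℝ) : Set (SpaceTime n) :=
  Metric.ball (0 : EuclideanSpace ℝ (Fin n)) R ×ˢ Set.Ioo (-T) 0

/-- The `i`-th spatial coordinate direction in space-time. -/
noncomputable def spaceDir {n : ℕ} (i : Fin n) : SpaceTime n :=
  (EuclideanSpace.single i (1 : ℝ), 0)

/-- The time direction in space-time. -/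
def timeDir (n : ℕ) : SpaceTime n := (0, 1)

/-- Smooth functions with compact support in `Ω`. -/
structure IsTestFunction {n : ℕ} (Ω : Set (SpaceTime n)) (φ : SpaceTime n → ℝ) : Prop where
  smooth : ContDiff ℝ ∞ φ
  hasCompactSupport : HasCompactSupport φ
  tsupport_subset : tsupport φ ⊆ Ω

/-- `g` is the weak (distributional) derivative of `u` on `Ω` in the direction `e`. -/
structure IsWeakDeriv {n : ℕ} (Ω : Set (SpaceTime n)) (e : SpaceTime n)
    (u g : SpaceTime n → ℝ) : Prop where
  locallyIntegrableOn : LocallyIntegrableOn u Ω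
  locallyIntegrableOn_deriv : LocallyIntegrableOn g Ω
  integral_eq : ∀ φ : SpaceTime n → ℝ, IsTestFunction Ω φ →
    ∫ X in Ω, u X * fderiv ℝ φ X e = -∫ X in Ω, g X * φ X

/-- `g ∈ L^q_loc(Ω)`. -/
def MemLpLoc {n : ℕ} (q : ℝ≥0∞) (Ω : Set (SpaceTime n)) (g : SpaceTime n → ℝ) : Prop :=
  ∀ K : Set (SpaceTime n), K ⊆ Ω → IsCompact K → MemLp g q (volume.restrict K)

/-- `u ∈ W^{2,1}_{q,loc}(Ω)`, with weak derivatives `u_t = ut`, `D_i u = Du i` and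
`D_{ij} u = D2u i j`: all of these functions exist and belong to `L^q_loc(Ω)`. -/
structure IsW21Loc {n : ℕ} (q : ℝ≥0∞) (Ω : Set (SpaceTime n)) (u ut : SpaceTime n → ℝ)
    (Du : Fin n → SpaceTime n → ℝ) (D2u : Fin n → Fin n → SpaceTime n → ℝ) : Prop where
  isWeakDeriv_time : IsWeakDeriv Ω (timeDir n) u ut
  isWeakDeriv_space : ∀ i, IsWeakDeriv Ω (spaceDir i) u (Du i)
  isWeakDeriv_space_space : ∀ i j, IsWeakDeriv Ω (spaceDir j) (Du i) (D2u i j)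
  memLpLoc : MemLpLoc q Ω u
  memLpLoc_time : MemLpLoc q Ω ut
  memLpLoc_space : ∀ i, MemLpLoc q Ω (Du i)
  memLpLoc_space_space : ∀ i j, MemLpLoc q Ω (D2u i j)

/-- The coefficients `a^{ij}`, `b^i`, `c` of a parabolic operator in nondivergence form. -/
structure ParabolicCoeffs (n : ℕ) where
  a : SpaceTime n → Matrix (Fin n) (Fin n) ℝ
  b : SpaceTime n → EuclideanSpace ℝ (Fin n)
  c : SpaceTime n → ℝ

/-- `Lu = -u_t + a^{ij} D_{ij} u + b^i D_i u + c u`. -/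
def ParabolicCoeffs.op {n : ℕ} (L : ParabolicCoeffs n) (u ut : SpaceTime n → ℝ)
    (Du : Fin n → SpaceTime n → ℝ) (D2u : Fin n → Fin n → SpaceTime n → ℝ)
    (X : SpaceTime n) : ℝ :=
  -ut X + ∑ i, ∑ j, L.a X i j * D2u i j X + ∑ i, L.b X i * Du i X + L.c X * u X

/-- The coefficients are measurable, `(a^{ij})` is symmetric with all eigenvalues in
`[lam0, Lam0]`, `|b| ≤ B`, `c ≤ c0`, and `c` is bounded, on `Ω`. -/
structure ParabolicCoeffs.IsBounded {n : ℕ} (L : ParabolicCoeffs n) (Ω : Set (SpaceTime n))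
    (lam0 Lam0 B c0 : ℝ) : Prop where
  aemeasurable_a : ∀ i j, AEMeasurable (fun X => L.a X i j) (volume.restrict Ω)
  aemeasurable_b : ∀ i, AEMeasurable (fun X => L.b X i) (volume.restrict Ω)
  aemeasurable_c : AEMeasurable L.c (volume.restrict Ω)
  isSymm : ∀ X ∈ Ω, (L.a X).IsSymm
  le_eigenvalue : ∀ X ∈ Ω, ∀ μ ∈ spectrum ℝ (L.a X), lam0 ≤ μ
  eigenvalue_le : ∀ X ∈ Ω, ∀ μ ∈ spectrum ℝ (L.a X), μ ≤ Lam0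
  norm_b_le : ∀ X ∈ Ω, ‖L.b X‖ ≤ B
  c_le : ∀ X ∈ Ω, L.c X ≤ c0
  c_bounded : ∃ M : ℝ, ∀ X ∈ Ω, |L.c X| ≤ M

/-- The scale-invariant quantity
`(lam0⁻ⁿ T R⁻²)^{1/(n+1)} (c0 R² + B R + Lam0 + R² T⁻¹)`. -/
noncomputable def parabolicScaleConst (n : ℕ) (R T lam0 Lam0 B c0 : ℝ) : ℝ :=
  ((lam0 ^ n)⁻¹ * T * (R ^ 2)⁻¹) ^ (1 / ((n : ℝ) + 1)) *
    (c0 * R ^ 2 + B * R + Lam0 + R ^ 2 * T⁻¹)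

/-!
The proof is the parabolic Aleksandrov-Bakelman-Pucci argument of Krylov and Tso, applied to a
power of a cutoff times the solution.

*Smooth functions.* Let `v` be smooth on `B_r × [τ₁, τ₂]` and nonpositive on the parabolic
boundary, with maximum `M > 0`. The planes `y ↦ ξ · y + h` with `r |ξ| < h` and `h + r |ξ| < M` form
a set of measure at least `c M^(n+1) / r^n`, and each of them touches `v` from above for the first time at
some interior point (`exists_mem_contactSet_legendreMap_eq`). There `v_t ≥ 0`, `D²v ≤ 0`, and the
plane is the image of the point under the map `(x, t) ↦ (Dv, v - x · Dv)`, whose Jacobian is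
`v_t det D²v` (`det_fderiv_legendreMap`). The area formula together with
`lam^n v_t det (-D²v) ≤ (v_t - tr (a D²v))^(n+1)` gives `abp_estimate`.

For `v = ζ^(2k) u`, with `ζ` vanishing on the parabolic boundary, positivity of the plane on `B_r`
gives `|Dv| (r - |x|) ≤ v` at contact points. Hence `ζ |Du| ≤ C u / r` there, and all terms produced
by the cutoff are bounded by a multiple of `ζ^(2k-2) u ≤ M^(1-1/k) u^(1/k)`
(`timeDeriv_sub_trace_le_of_mem_contactSet`, `pow_mul_le_rpow_mul_rpow`). The power of `M` is absorbed
into the left side (`le_of_le_add_mul_rpow`), which leaves the `L^q` norm of `u⁺` for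
`q = (n + 1) / k`; a large `k` makes `q ≤ p`, and Hölder's inequality passes from `q` to `p`. The
powers of `R`, `T` and `lam` combine to the scale-invariant constant
(`rpow_mul_mul_rpow_eq_parabolicScaleConst`, `rpow_le_parabolicScaleConst_mul`). The result is
`exists_interior_estimate_of_contDiff`.

*Sobolev functions.* On a compact part of the cylinder the mollifications `w_j` of `u` converge
pointwise and boundedly, and `L w_j → L u` in `L^(n+1)` because the coefficients of `L` are bounded
(`IsW21Loc.exists_smooth_approximation`). The smooth estimate requires no regularity of the
coefficients, so it applies to `L` and `w_j`, and it passes to the limit.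
-/

/-! ### Matrix inequalities and a block determinant -/

open Matrix in
theorem Matrix.IsSymm.posSemidef_sub_smul_one {n : ℕ} {A : Matrix (Fin n) (Fin n) ℝ} {l : ℝ}
    (hA : A.IsSymm) (h : ∀ μ ∈ spectrum ℝ A, l ≤ μ) :
    (A - l • (1 : Matrix (Fin n) (Fin n) ℝ)).PosSemidef := by
  have hH : (A - l • (1 : Matrix (Fin n) (Fin n) ℝ)).IsHermitian := by
    simp [Matrix.IsHermitian, Matrix.conjTranspose_eq_transpose_of_trivial, hA.eq]
  rw [hH.posSemidef_iff_eigenvalues_nonneg]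
  intro i
  have h1 := hH.eigenvalues_mem_spectrum_real i
  have h2 : hH.eigenvalues i + l ∈ spectrum ℝ A := by
    rw [spectrum.mem_iff] at h1 ⊢
    convert! h1 using 2
    rw [Algebra.algebraMap_eq_smul_one, Algebra.algebraMap_eq_smul_one, add_smul]
    abel
  have := h _ h2
  simp only [Pi.zero_apply]
  linarith

theorem Matrix.IsSymm.posSemidef_smul_one_sub {n : ℕ} {A : Matrix (Fin n) (Fin n) ℝ} {l : ℝ}
    (hA : A.IsSymm) (h : ∀ μ ∈ spectrum ℝ A, μ ≤ l) :
    (l • (1 : Matrix (Fin n) (Fin n) ℝ) - A).PosSemidef := by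
  have h1 := (show (-A).IsSymm from hA.neg).posSemidef_sub_smul_one (l := -l) (fun μ hμ => by
    have : -μ ∈ spectrum ℝ A := by
      rw [← spectrum.neg_eq] at hμ
      simpa using hμ
    linarith [h _ this])
  convert h1 using 1
  rw [neg_smul]; abel

theorem Matrix.PosSemidef.trace_mul_nonneg {n : ℕ} {A N : Matrix (Fin n) (Fin n) ℝ}
    (hA : A.PosSemidef) (hN : N.PosSemidef) : 0 ≤ (A * N).trace := by
  obtain ⟨B, rfl⟩ := by
    open scoped MatrixOrder in
    exact CStarAlgebra.nonneg_iff_eq_star_mul_self.mp hN.nonneg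
  rw [← mul_assoc, Matrix.trace_mul_comm, ← mul_assoc]
  exact (hA.mul_mul_conjTranspose_same B).trace_nonneg

theorem Matrix.PosSemidef.det_le_trace_pow {n : ℕ} {N : Matrix (Fin n) (Fin n) ℝ}
    (hN : N.PosSemidef) : N.det ≤ N.trace ^ n := by
  have h1 := hN.1.det_eq_prod_eigenvalues
  have h2 := hN.1.trace_eq_sum_eigenvalues
  simp only [RCLike.ofReal_real_eq_id, id] at h1 h2
  rw [h1, h2]
  calc ∏ i, hN.1.eigenvalues i ≤ ∏ _i : Fin n, ∑ j, hN.1.eigenvalues j :=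
        Finset.prod_le_prod (fun i _ => hN.eigenvalues_nonneg i) (fun i _ =>
          Finset.single_le_sum (fun j _ => hN.eigenvalues_nonneg j) (Finset.mem_univ i))
    _ = _ := by simp

/-- A non-sharp substitute for the arithmetic-geometric mean inequality
`det A * det N ≤ (tr (A N) / n) ^ n`; only the lower bound `A ≥ l` enters. -/
theorem Matrix.PosSemidef.pow_mul_det_le_trace_mul_pow {n : ℕ} {A N : Matrix (Fin n) (Fin n) ℝ}
    {l : ℝ} (hl : 0 ≤ l) (hA : (A - l • (1 : Matrix (Fin n) (Fin n) ℝ)).PosSemidef)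
    (hN : N.PosSemidef) : l ^ n * N.det ≤ (A * N).trace ^ n := by
  have h1 := hA.trace_mul_nonneg hN
  rw [sub_mul, Matrix.trace_sub, smul_mul_assoc, one_mul, Matrix.trace_smul, smul_eq_mul] at h1
  calc l ^ n * N.det ≤ l ^ n * N.trace ^ n := by gcongr; exact hN.det_le_trace_pow
    _ = (l * N.trace) ^ n := by ring
    _ ≤ _ := by
      have := hN.trace_nonneg
      gcongr
      linarith

open Matrix in
theorem Matrix.PosSemidef.abs_dotProduct_mulVec_le {n : ℕ} {A : Matrix (Fin n) (Fin n) ℝ} {l : ℝ}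
    (hA : A.PosSemidef) (h : (l • (1 : Matrix (Fin n) (Fin n) ℝ) - A).PosSemidef)
    (x y : Fin n → ℝ) : 2 * |x ⬝ᵥ (A *ᵥ y)| ≤ l * (x ⬝ᵥ x + y ⬝ᵥ y) := by
  have hs : y ⬝ᵥ (A *ᵥ x) = x ⬝ᵥ (A *ᵥ y) := by
    have : Aᵀ = A := by simpa [Matrix.IsHermitian] using hA.1
    rw [Matrix.dotProduct_mulVec, ← Matrix.mulVec_transpose, this, dotProduct_comm]
  have h1 := hA.dotProduct_mulVec_nonneg (x + y)
  have h2 := hA.dotProduct_mulVec_nonneg (x - y)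
  have h3 := h.dotProduct_mulVec_nonneg x
  have h4 := h.dotProduct_mulVec_nonneg y
  simp only [star_trivial, mulVec_add, mulVec_sub, sub_mulVec, smul_mulVec, one_mulVec,
    dotProduct_add, add_dotProduct, dotProduct_sub, sub_dotProduct, dotProduct_smul,
    smul_eq_mul, hs] at h1 h2 h3 h4
  rw [← abs_two, ← abs_mul, abs_le]
  constructor <;> linarith

theorem Matrix.PosSemidef.abs_apply_le {n : ℕ} {A : Matrix (Fin n) (Fin n) ℝ} {l : ℝ}
    (hA : A.PosSemidef) (h : (l • (1 : Matrix (Fin n) (Fin n) ℝ) - A).PosSemidef)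
    (i j : Fin n) : |A i j| ≤ l := by
  have := hA.abs_dotProduct_mulVec_le h (Pi.single i 1) (Pi.single j 1)
  simp at this
  linarith

theorem Matrix.trace_le_of_posSemidef_smul_one_sub {n : ℕ} {A : Matrix (Fin n) (Fin n) ℝ} {l : ℝ}
    (h : (l • (1 : Matrix (Fin n) (Fin n) ℝ) - A).PosSemidef) : A.trace ≤ n * l := by
  have := h.trace_nonneg
  simp at this
  linarith

/-- The determinant of a block triangular endomorphism of `E × ℝ`. -/
theorem LinearMap.det_prod_blockTriangular {E : Type*} [AddCommGroup E] [Module ℝ E]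
    [FiniteDimensional ℝ E] (A : E →ₗ[ℝ] E) (w : E) (α : ℝ) (F : E × ℝ →ₗ[ℝ] E × ℝ)
    (hF : ∀ y s, F (y, s) = (A y + s • w, s * α)) : LinearMap.det F = LinearMap.det A * α := by
  have : F = (LinearMap.prodMap LinearMap.id (α • LinearMap.id)) ∘ₗ
      LinearMap.transvection (LinearMap.snd ℝ E ℝ) (w, 0) ∘ₗ
      (LinearMap.prodMap A LinearMap.id) := by
    apply LinearMap.ext
    rintro ⟨y, s⟩
    rw [hF]
    simp [LinearMap.transvection.apply, mul_comm]
  rw [this, LinearMap.det_comp, LinearMap.det_comp, LinearMap.transvection.det,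
    LinearMap.det_prodMap, LinearMap.det_prodMap]
  simp [mul_comm]

/-! ### The Jacobian of the parabolic Legendre map -/

/-- The spatial gradient of a function on space-time. -/
noncomputable def spaceGrad {n : ℕ} (v : SpaceTime n → ℝ) (X : SpaceTime n) :
    EuclideanSpace ℝ (Fin n) :=
  WithLp.toLp 2 fun i => fderiv ℝ v X (spaceDir i)

/-- The spatial Hessian matrix of a function on space-time. -/
noncomputable def spaceHess {n : ℕ} (v : SpaceTime n → ℝ) (X : SpaceTime n) :
    Matrix (Fin n) (Fin n) ℝ :=
  fun i j => fderiv ℝ (fun Y => fderiv ℝ v Y (spaceDir i)) X (spaceDir j)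

/-- The time derivative of a function on space-time. -/
noncomputable def timeDeriv {n : ℕ} (v : SpaceTime n → ℝ) (X : SpaceTime n) : ℝ :=
  fderiv ℝ v X (timeDir n)

/-- The parabolic Legendre map `(x, t) ↦ (Dv, v - x · Dv)`, which sends a point to the slope and
the height at the origin of the spatial tangent plane of `v` there. -/
noncomputable def legendreMap {n : ℕ} (v : SpaceTime n → ℝ) (X : SpaceTime n) : SpaceTime n :=
  (spaceGrad v X, v X - inner ℝ X.1 (spaceGrad v X))

theorem mk_zero_eq_sum_spaceDir {n : ℕ} (y : EuclideanSpace ℝ (Fin n)) :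
    ((y, 0) : SpaceTime n) = ∑ i, y i • spaceDir i := by
  have h := (EuclideanSpace.basisFun (Fin n) ℝ).sum_repr y
  refine Prod.ext ?_ ?_
  · rw [Prod.fst_sum]
    simpa [spaceDir] using h.symm
  · rw [Prod.snd_sum]
    simp [spaceDir]

theorem inner_spaceGrad {n : ℕ} (v : SpaceTime n → ℝ) (X : SpaceTime n)
    (y : EuclideanSpace ℝ (Fin n)) : inner ℝ y (spaceGrad v X) = fderiv ℝ v X (y, 0) := by
  rw [mk_zero_eq_sum_spaceDir, map_sum]
  simp [spaceGrad, PiLp.inner_apply, mul_comm]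

theorem fderiv_spaceTime_apply {n : ℕ} (v : SpaceTime n → ℝ) (X : SpaceTime n)
    (y : EuclideanSpace ℝ (Fin n)) (s : ℝ) :
    fderiv ℝ v X (y, s) = inner ℝ y (spaceGrad v X) + s * timeDeriv v X := by
  rw [inner_spaceGrad, timeDeriv, ← smul_eq_mul, ← map_smul, ← map_add]
  simp [timeDir]

section Smooth

variable {n : ℕ} {v : SpaceTime n → ℝ}

theorem ContDiff.fderiv_apply_const (hv : ContDiff ℝ 2 v) (e : SpaceTime n) :
    ContDiff ℝ 1 fun Y => fderiv ℝ v Y e :=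
  (hv.fderiv_right (m := 1) (by norm_num)).clm_apply contDiff_const

theorem ContDiff.contDiff_spaceGrad (hv : ContDiff ℝ 2 v) : ContDiff ℝ 1 (spaceGrad v) := by
  rw [contDiff_piLp]
  exact fun i => hv.fderiv_apply_const _

theorem ContDiff.continuous_spaceHess (hv : ContDiff ℝ 2 v) : Continuous (spaceHess v) := by
  refine continuous_matrix fun i j => ?_
  exact ((hv.fderiv_apply_const (spaceDir i)).continuous_fderiv (by norm_num)).clm_apply
    continuous_const

theorem ContDiff.continuous_timeDeriv (hv : ContDiff ℝ 2 v) : Continuous (timeDeriv v) :=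
  (hv.continuous_fderiv (by norm_num)).clm_apply continuous_const

theorem ContDiff.isSymm_spaceHess (hv : ContDiff ℝ 2 v) (X : SpaceTime n) :
    (spaceHess v X).IsSymm := by
  ext i j
  have key : ∀ i j, spaceHess v X i j = fderiv ℝ (fderiv ℝ v) X (spaceDir j) (spaceDir i) := by
    intro i j
    have hd : DifferentiableAt ℝ (fderiv ℝ v) X :=
      (hv.fderiv_right (m := 1) (by norm_num)).differentiable (by norm_num) X
    simp only [spaceHess]
    rw [fderiv_clm_apply hd (differentiableAt_const _)]
    simp
  rw [Matrix.transpose_apply, key, key]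
  exact (hv.contDiffAt.isSymmSndFDerivAt (by simp)).eq _ _

theorem ContDiff.fderiv_spaceGrad_apply (hv : ContDiff ℝ 2 v) (X Z : SpaceTime n) (i : Fin n) :
    fderiv ℝ (spaceGrad v) X Z i = fderiv ℝ (fun Y => fderiv ℝ v Y (spaceDir i)) X Z := by
  have h := (hv.contDiff_spaceGrad.differentiable (by norm_num) X).hasFDerivAt
  have h2 := ((PiLp.hasFDerivAt_apply (𝕜 := ℝ) 2 (spaceGrad v X) i).comp X h).fderiv
  change fderiv ℝ (fun Y => fderiv ℝ v Y (spaceDir i)) X = _ at h2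
  rw [h2]
  simp

theorem det_fderiv_legendreMap (hv : ContDiff ℝ 2 v) (X : SpaceTime n) :
    (fderiv ℝ (legendreMap v) X).det = (spaceHess v X).det * timeDeriv v X := by
  have hG : DifferentiableAt ℝ (spaceGrad v) X := hv.contDiff_spaceGrad.differentiable (by norm_num) X
  have hvd : DifferentiableAt ℝ v X := hv.differentiable (by norm_num) X
  have hform : ∀ Z, fderiv ℝ (legendreMap v) X Z = (fderiv ℝ (spaceGrad v) X Z,
      Z.2 * timeDeriv v X - inner ℝ X.1 (fderiv ℝ (spaceGrad v) X Z)) := by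
    intro Z
    have hin : HasFDerivAt (fun Y : SpaceTime n => inner ℝ Y.1 (spaceGrad v Y)) _ X :=
      hasFDerivAt_fst.inner ℝ hG.hasFDerivAt
    have := (hG.hasFDerivAt.prodMk (hvd.hasFDerivAt.sub hin)).fderiv
    change fderiv ℝ (legendreMap v) X = _ at this
    rw [this]
    obtain ⟨y, s⟩ := Z
    simp [fderivInnerCLM_apply, fderiv_spaceTime_apply v X y s]
    ring
  let f : SpaceTime n →ₗ[ℝ] ℝ := (innerₗ _ X.1) ∘ₗ LinearMap.fst ℝ _ _
  have hS : LinearMap.det (LinearMap.transvection f ((0, 1) : SpaceTime n)) = 1 := by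
    rw [LinearMap.transvection.det]; simp [f]
  let A : EuclideanSpace ℝ (Fin n) →ₗ[ℝ] EuclideanSpace ℝ (Fin n) :=
    (fderiv ℝ (spaceGrad v) X : SpaceTime n →ₗ[ℝ] _) ∘ₗ LinearMap.inl ℝ _ _
  have hA : A = Matrix.toEuclideanLin (spaceHess v X) := by
    ext y i
    simp only [A, LinearMap.comp_apply, LinearMap.inl_apply, ContinuousLinearMap.coe_coe]
    rw [hv.fderiv_spaceGrad_apply, mk_zero_eq_sum_spaceDir, map_sum]
    simp [Matrix.toLpLin_apply, Matrix.mulVec, dotProduct, spaceHess, mul_comm]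
  have hdA : LinearMap.det A = (spaceHess v X).det := by
    rw [hA]
    simp
  have hT := LinearMap.det_prod_blockTriangular A (fderiv ℝ (spaceGrad v) X (0, 1))
    (timeDeriv v X)
    (LinearMap.transvection f ((0, 1) : SpaceTime n) ∘ₗ (fderiv ℝ (legendreMap v) X).toLinearMap)
    (by
      intro y s
      have : ((y, s) : SpaceTime n) = (y, 0) + s • (0, 1) := by simp
      simp only [LinearMap.comp_apply, ContinuousLinearMap.coe_coe, hform,
        LinearMap.transvection.apply, A, LinearMap.inl_apply, f, LinearMap.fst_apply,
        innerₗ_apply_apply]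
      refine Prod.ext ?_ ?_
      · simp only [this, map_add, map_smul]
        simp
      · simp)
  rw [LinearMap.det_comp, hS, one_mul, hdA] at hT
  exact hT

end Smooth

/-! ### Contact points and the Aleksandrov-Bakelman-Pucci-Krylov-Tso estimate -/

instance (n : ℕ) : (volume : Measure (SpaceTime n)).IsAddHaarMeasure :=
  inferInstanceAs ((volume : Measure (EuclideanSpace ℝ (Fin n))).prod
    (volume : Measure ℝ)).IsAddHaarMeasure

theorem deriv_deriv_nonpos_of_isLocalMax {g : ℝ → ℝ} {a : ℝ} (hg : ContinuousAt g a)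
    (h : IsLocalMax g a) : deriv (deriv g) a ≤ 0 := by
  by_contra! hpos
  have hmin := isLocalMin_of_deriv_deriv_pos hpos h.deriv_eq_zero hg
  have hconst : g =ᶠ[nhds a] fun _ => g a := by
    filter_upwards [h, hmin] with x h1 h2 using le_antisymm h1 h2
  have h1 : deriv g =ᶠ[nhds a] fun _ => 0 := by
    simpa using hconst.deriv
  have h2 := h1.deriv_eq
  simp at h2
  linarith

/-- The points of the cylinder `B_r × (τ₁, τ₂]` which satisfy the pointwise
consequences of being a contact point of `v` with a plane that is positive on `B_r`. -/
def contactSet {n : ℕ} (v : SpaceTime n → ℝ) (r τ₁ τ₂ : ℝ) : Set (SpaceTime n) :=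
  {X | X ∈ Metric.ball (0 : EuclideanSpace ℝ (Fin n)) r ×ˢ Set.Ioc τ₁ τ₂ ∧ 0 < v X ∧
    0 ≤ timeDeriv v X ∧ (-spaceHess v X).PosSemidef ∧ ‖spaceGrad v X‖ * (r - ‖X.1‖) ≤ v X}

section Contact

variable {n : ℕ} {v : SpaceTime n → ℝ} {r τ₁ τ₂ : ℝ}

theorem ContDiff.measurableSet_contactSet (hv : ContDiff ℝ 2 v) :
    MeasurableSet (contactSet v r τ₁ τ₂) := by
  have hc := hv.continuous
  have hH := hv.continuous_spaceHess
  have h1 : {X | (-spaceHess v X).PosSemidef} =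
      ⋂ x : Fin n → ℝ, {X | 0 ≤ x ⬝ᵥ ((-spaceHess v X).mulVec x)} := by
    ext X
    simp only [Set.mem_ofPred_eq, Set.mem_iInter]
    refine ⟨fun h x => by simpa using h.dotProduct_mulVec_nonneg x, fun h =>
      Matrix.PosSemidef.of_dotProduct_mulVec_nonneg ?_ (fun x => by simpa using h x)⟩
    simpa [Matrix.IsHermitian] using (hv.isSymm_spaceHess X).eq
  have h2 : IsClosed {X | (-spaceHess v X).PosSemidef} := by
    rw [h1]
    refine isClosed_iInter fun x => isClosed_le continuous_const ?_
    exact continuous_const.dotProduct (hH.neg.matrix_mulVec continuous_const)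
  have hcyl : MeasurableSet (Metric.ball (0 : EuclideanSpace ℝ (Fin n)) r ×ˢ Set.Ioc τ₁ τ₂) :=
    measurableSet_ball.prod measurableSet_Ioc
  have hpos : MeasurableSet {X | 0 < v X} := (isOpen_lt continuous_const hc).measurableSet
  have htime : MeasurableSet {X | 0 ≤ timeDeriv v X} :=
    (isClosed_le continuous_const hv.continuous_timeDeriv).measurableSet
  have hgrad : MeasurableSet {X : SpaceTime n | ‖spaceGrad v X‖ * (r - ‖X.1‖) ≤ v X} :=
    (isClosed_le (hv.contDiff_spaceGrad.continuous.norm.mul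
      (continuous_const.sub continuous_fst.norm)) hc).measurableSet
  exact hcyl.inter (hpos.inter (htime.inter (h2.measurableSet.inter hgrad)))

theorem fderiv_fderiv_eq_dotProduct (hv : ContDiff ℝ 2 v) (X : SpaceTime n) (x : Fin n → ℝ) :
    fderiv ℝ (fun Y => fderiv ℝ v Y (WithLp.toLp 2 x, 0)) X (WithLp.toLp 2 x, 0) =
      x ⬝ᵥ (spaceHess v X).mulVec x := by
  have h1 : (fun Y => fderiv ℝ v Y (WithLp.toLp 2 x, 0)) =
      fun Y => ∑ i, x i * fderiv ℝ v Y (spaceDir i) := by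
    funext Y
    rw [mk_zero_eq_sum_spaceDir, map_sum]
    simp
  have hd : ∀ i : Fin n, DifferentiableAt ℝ (fun Y => fderiv ℝ v Y (spaceDir i)) X := fun i =>
    (hv.fderiv_apply_const _).differentiable (by norm_num) X
  rw [h1, fderiv_fun_sum (fun i _ => (hd i).const_mul _)]
  simp only [sum_apply, dotProduct, Matrix.mulVec]
  refine Finset.sum_congr rfl fun i _ => ?_
  rw [fderiv_const_mul (hd i), mk_zero_eq_sum_spaceDir, map_sum]
  simp only [smul_apply, map_smul, smul_eq_mul, spaceHess, Finset.mul_sum]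
  exact Finset.sum_congr rfl fun j _ => by ring

/-- Every plane `y ↦ ξ · y + h` that is positive on `B_r` and lies below `v` at some point of the
cylinder touches `v`, for the first time, at a point of the contact set: this point is found by
minimising time on the compact set where `v` is at least the plane. -/
theorem exists_mem_contactSet_legendreMap_eq (hv : ContDiff ℝ 2 v)
    (hbd : ∀ X ∈ Metric.closedBall (0 : EuclideanSpace ℝ (Fin n)) r ×ˢ Set.Icc τ₁ τ₂,
      (‖X.1‖ = r ∨ X.2 = τ₁) → v X ≤ 0)
    {X₀ : SpaceTime n}
    (hX₀ : X₀ ∈ Metric.closedBall (0 : EuclideanSpace ℝ (Fin n)) r ×ˢ Set.Icc τ₁ τ₂)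
    {ξ : EuclideanSpace ℝ (Fin n)} {h : ℝ} (h1 : r * ‖ξ‖ < h) (h2 : h + r * ‖ξ‖ < v X₀) :
    ∃ X ∈ contactSet v r τ₁ τ₂, legendreMap v X = (ξ, h) := by
  set K := Metric.closedBall (0 : EuclideanSpace ℝ (Fin n)) r ×ˢ Set.Icc τ₁ τ₂ with hK
  have hKc : IsCompact K := (isCompact_closedBall 0 r).prod isCompact_Icc
  let w : SpaceTime n → ℝ := fun X => v X - inner ℝ X.1 ξ - h
  have hwc : Continuous w := (hv.continuous.sub (continuous_fst.inner continuous_const)).sub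
    continuous_const
  have hinner : ∀ X ∈ K, |inner ℝ X.1 ξ| ≤ r * ‖ξ‖ := fun X hX => by
    refine (abs_real_inner_le_norm _ _).trans ?_
    have : ‖X.1‖ ≤ r := by simpa using hX.1
    gcongr
  have hZc : IsCompact (K ∩ {X | 0 ≤ w X}) :=
    hKc.inter_right (isClosed_le continuous_const hwc)
  obtain ⟨X, ⟨hXK, hXw⟩, hXmin⟩ := hZc.exists_isMinOn ⟨X₀, hX₀, by
    have := abs_le.1 (hinner X₀ hX₀)
    simp only [Set.mem_ofPred_eq, w]; linarith⟩ continuous_snd.continuousOn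
  simp only [Set.mem_ofPred_eq] at hXw
  have hneg : ∀ Y ∈ K, (‖Y.1‖ = r ∨ Y.2 = τ₁) → w Y < 0 := fun Y hY hb => by
    have := abs_le.1 (hinner Y hY)
    have := hbd Y hY hb
    simp only [w]; linarith
  have hx1 : ‖X.1‖ < r := by
    refine lt_of_le_of_ne (by simpa using hXK.1) fun h => ?_
    linarith [hneg X hXK (Or.inl h)]
  have ht1 : τ₁ < X.2 := by
    refine lt_of_le_of_ne hXK.2.1 fun h => ?_
    linarith [hneg X hXK (Or.inr h.symm)]
  -- strictly before the touching time the plane lies above `v`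
  have hbefore : ∀ Y ∈ K, Y.2 < X.2 → w Y < 0 := fun Y hY hlt => by
    by_contra! hge
    have := hXmin ⟨hY, hge⟩
    simp only [Set.mem_ofPred_eq] at this
    linarith
  have hat : ∀ y ∈ Metric.closedBall (0 : EuclideanSpace ℝ (Fin n)) r, w (y, X.2) ≤ 0 := by
    intro y hy
    have hcont : ContinuousWithinAt (fun s => w (y, s)) (Set.Iio X.2) X.2 :=
      (hwc.comp (continuous_const.prodMk continuous_id)).continuousWithinAt
    refine le_of_tendsto hcont ?_
    have : ∀ᶠ s in nhdsWithin X.2 (Set.Iio X.2), τ₁ < s :=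
      nhdsWithin_le_nhds (lt_mem_nhds ht1)
    filter_upwards [this, self_mem_nhdsWithin] with s hs1 hs2
    exact (hbefore (y, s) ⟨hy, hs1.le, (le_of_lt hs2).trans hXK.2.2⟩ hs2).le
  have hw0 : w X = 0 := le_antisymm (hat X.1 hXK.1) hXw
  have hvX : v X = inner ℝ X.1 ξ + h := by simp only [w] at hw0; linarith
  -- one-dimensional restrictions in spatial directions have a local maximum
  have hmax : ∀ e : EuclideanSpace ℝ (Fin n),
      IsLocalMax (fun s : ℝ => v (X + s • (e, 0)) - s * inner ℝ e ξ) 0 := by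
    intro e
    have hc : ContinuousAt (fun s : ℝ => ‖X.1 + s • e‖) 0 := by fun_prop
    have : ∀ᶠ s : ℝ in nhds 0, ‖X.1 + s • e‖ < r :=
      hc.eventually_lt continuousAt_const (by simpa using hx1)
    filter_upwards [this] with s hs
    have h3 := hat (X.1 + s • e) (by simpa using hs.le)
    have h4 : X + s • ((e, 0) : SpaceTime n) = (X.1 + s • e, X.2) := by
      ext <;> simp
    simp only [w, inner_add_left, inner_smul_left, RCLike.conj_to_real] at h3
    simp only [h4, zero_smul, add_zero, zero_mul, sub_zero, hvX]
    linarith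
  have hline : ∀ (e : EuclideanSpace ℝ (Fin n)) (s : ℝ),
      HasDerivAt (fun s : ℝ => v (X + s • (e, 0)) - s * inner ℝ e ξ)
        (fderiv ℝ v (X + s • (e, 0)) (e, 0) - inner ℝ e ξ) s := by
    intro e s
    have h3 : HasDerivAt (fun s : ℝ => X + s • ((e, 0) : SpaceTime n)) (e, 0) s := by
      simpa using ((hasDerivAt_id s).smul_const ((e, 0) : SpaceTime n)).const_add X
    have h4 := (hv.differentiable (by norm_num) (X + s • (e, 0))).hasFDerivAt.comp_hasDerivAt s h3
    have h5 := h4.sub ((hasDerivAt_id s).mul_const (inner ℝ e ξ))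
    rwa [one_mul] at h5
  have hgradX : spaceGrad v X = ξ := by
    refine ext_inner_left ℝ fun e => ?_
    have h3 := (hmax e).hasDerivAt_eq_zero (hline e 0)
    rw [inner_spaceGrad]
    simp only [zero_smul, add_zero] at h3
    linarith
  have hhess : (-spaceHess v X).PosSemidef := by
    refine Matrix.PosSemidef.of_dotProduct_mulVec_nonneg ?_ fun x => ?_
    · simpa [Matrix.IsHermitian] using (hv.isSymm_spaceHess X).eq
    let e : EuclideanSpace ℝ (Fin n) := WithLp.toLp 2 x
    have h3 := deriv_deriv_nonpos_of_isLocalMax (hline e 0).continuousAt (hmax e)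
    have h4 : deriv (fun s : ℝ => v (X + s • (e, 0)) - s * inner ℝ e ξ) =
        fun s => fderiv ℝ v (X + s • (e, 0)) (e, 0) - inner ℝ e ξ :=
      funext fun s => (hline e s).deriv
    have h5 : HasDerivAt (fun s : ℝ => X + s • ((e, 0) : SpaceTime n)) (e, 0) 0 := by
      simpa using ((hasDerivAt_id (0 : ℝ)).smul_const ((e, 0) : SpaceTime n)).const_add X
    have h6 : HasFDerivAt (fun Y => fderiv ℝ v Y (e, 0))
        (fderiv ℝ (fun Y => fderiv ℝ v Y (e, 0)) X) (X + (0 : ℝ) • ((e, 0) : SpaceTime n)) := by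
      simpa using ((hv.fderiv_apply_const (e, 0)).differentiable (by norm_num) X).hasFDerivAt
    have h7 := (h6.comp_hasDerivAt 0 h5).sub_const (inner ℝ e ξ)
    have h8 := h7.deriv
    rw [h4] at h3
    simp only [Function.comp_def] at h8
    rw [h8, fderiv_fderiv_eq_dotProduct hv] at h3
    simpa [Matrix.neg_mulVec] using h3
  have htime : 0 ≤ timeDeriv v X := by
    have hmaxt : IsLocalMaxOn v (segment ℝ X (X.1, τ₁)) X := by
      refine IsMaxOn.localize fun Y hY => ?_
      have hY2 : Y.1 = X.1 ∧ Y.2 ≤ X.2 ∧ τ₁ ≤ Y.2 := by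
        obtain ⟨a, b, ha, hb, hab, rfl⟩ := hY
        obtain rfl : a = 1 - b := by linarith
        refine ⟨?_, ?_, ?_⟩
        · simp [← add_smul]
        · simp only [Prod.snd_add, Prod.smul_snd, smul_eq_mul]; nlinarith
        · simp only [Prod.snd_add, Prod.smul_snd, smul_eq_mul]; nlinarith
      obtain ⟨hY1, hY2, hY3⟩ := hY2
      have hYK : Y ∈ K := ⟨hY1 ▸ hXK.1, hY3, hY2.trans hXK.2.2⟩
      have : w Y ≤ 0 := by
        rcases hY2.lt_or_eq with hlt | heq
        · exact (hbefore Y hYK hlt).le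
        · have : Y = X := Prod.ext hY1 heq
          rw [this, hw0]
      simp only [w, hY1] at this
      simp only [Set.mem_ofPred_eq, hvX]
      linarith
    have h3 := hmaxt.hasFDerivWithinAt_nonpos
      ((hv.differentiable (by norm_num) X).hasFDerivAt.hasFDerivWithinAt)
      (sub_mem_posTangentConeAt_of_segment_subset subset_rfl)
    have h4 : ((X.1, τ₁) : SpaceTime n) - X = (τ₁ - X.2) • timeDir n := by
      ext <;> simp [timeDir]
    rw [h4, map_smul, smul_eq_mul] at h3
    by_contra! hlt
    have : 0 < (τ₁ - X.2) * timeDeriv v X := mul_pos_of_neg_of_neg (by linarith) hlt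
    simp only [timeDeriv] at this
    linarith
  have hin : -(‖X.1‖ * ‖ξ‖) ≤ inner ℝ X.1 ξ := (abs_le.1 (abs_real_inner_le_norm _ _)).1
  refine ⟨X, ⟨⟨by simpa using hx1, ht1, hXK.2.2⟩, ?_, htime, hhess, ?_⟩, ?_⟩
  · have := abs_le.1 (hinner X hXK)
    linarith
  · rw [hgradX, hvX]
    nlinarith
  · simp [legendreMap, hgradX, hvX]

/-- The Aleksandrov-Bakelman-Pucci-Krylov-Tso estimate for a smooth function `v` that is
nonpositive on the parabolic boundary. The left side is a lower bound for the measure of the set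
of planes that are positive on `B_r` and below `v X₀` at `X₀`. -/
theorem abp_estimate (hv : ContDiff ℝ 2 v) (hr : 0 < r)
    (hbd : ∀ X ∈ Metric.closedBall (0 : EuclideanSpace ℝ (Fin n)) r ×ˢ Set.Icc τ₁ τ₂,
      (‖X.1‖ = r ∨ X.2 = τ₁) → v X ≤ 0)
    {X₀ : SpaceTime n}
    (hX₀ : X₀ ∈ Metric.closedBall (0 : EuclideanSpace ℝ (Fin n)) r ×ˢ Set.Icc τ₁ τ₂)
    (hpos : 0 < v X₀) {lam : ℝ} (hlam : 0 ≤ lam) {a : SpaceTime n → Matrix (Fin n) (Fin n) ℝ}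
    (ha : ∀ X ∈ contactSet v r τ₁ τ₂,
      (a X - lam • (1 : Matrix (Fin n) (Fin n) ℝ)).PosSemidef)
    {F : SpaceTime n → ℝ}
    (hF : ∀ X ∈ contactSet v r τ₁ τ₂, timeDeriv v X - (a X * spaceHess v X).trace ≤ F X) :
    ENNReal.ofReal (lam ^ n * ((v X₀ / (4 * r)) ^ n * (v X₀ / 2))) *
        volume (Metric.ball (0 : EuclideanSpace ℝ (Fin n)) 1) ≤
      ∫⁻ X in contactSet v r τ₁ τ₂, ENNReal.ofReal (F X ^ (n + 1)) := by
  set M := v X₀ with hM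
  -- a product set inside `{(ξ, h) | r ‖ξ‖ < h, h + r ‖ξ‖ < M}`
  have hD : Metric.ball (0 : EuclideanSpace ℝ (Fin n)) (M / (4 * r)) ×ˢ
      Set.Ioo (M / 4) (3 * M / 4) ⊆ legendreMap v '' contactSet v r τ₁ τ₂ := by
    rintro ⟨ξ, h⟩ ⟨hξ, hh1, hh2⟩
    have hξ' : ‖ξ‖ < M / (4 * r) := by simpa using hξ
    have h3 : r * ‖ξ‖ < M / 4 := by
      calc r * ‖ξ‖ < r * (M / (4 * r)) := by gcongr
        _ = M / 4 := by field_simp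
    exact exists_mem_contactSet_legendreMap_eq hv hbd hX₀ (by simp only at hh1; linarith)
      (by simp only at hh2; linarith)
  have hdiff : Differentiable ℝ (legendreMap v) :=
    ((hv.contDiff_spaceGrad.prodMk ((hv.of_le (by norm_num)).sub
      (contDiff_fst.inner ℝ hv.contDiff_spaceGrad))).differentiable (by norm_num))
  have harea := addHaar_image_le_lintegral_abs_det_fderiv volume
    (hv.measurableSet_contactSet (r := r) (τ₁ := τ₁) (τ₂ := τ₂))
    (fun X _ => (hdiff X).hasFDerivAt.hasFDerivWithinAt)
  have hvol : volume (Metric.ball (0 : EuclideanSpace ℝ (Fin n)) (M / (4 * r)) ×ˢ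
      Set.Ioo (M / 4) (3 * M / 4)) = ENNReal.ofReal ((M / (4 * r)) ^ n * (M / 2)) *
        volume (Metric.ball (0 : EuclideanSpace ℝ (Fin n)) 1) := by
    rw [Measure.volume_eq_prod, Measure.prod_prod, Measure.addHaar_ball_of_pos _ _ (by positivity),
      Real.volume_Ioo, ENNReal.ofReal_mul (by positivity), finrank_euclideanSpace_fin,
      show 3 * M / 4 - M / 4 = M / 2 by ring]
    ring
  calc ENNReal.ofReal (lam ^ n * ((M / (4 * r)) ^ n * (M / 2))) *
        volume (Metric.ball (0 : EuclideanSpace ℝ (Fin n)) 1)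
      = ENNReal.ofReal (lam ^ n) * volume (Metric.ball (0 : EuclideanSpace ℝ (Fin n))
          (M / (4 * r)) ×ˢ Set.Ioo (M / 4) (3 * M / 4)) := by
        rw [hvol, ENNReal.ofReal_mul (by positivity), mul_assoc]
    _ ≤ ENNReal.ofReal (lam ^ n) * ∫⁻ X in contactSet v r τ₁ τ₂,
          ENNReal.ofReal |(fderiv ℝ (legendreMap v) X).det| := by
        gcongr
        exact (measure_mono hD).trans harea
    _ = ∫⁻ X in contactSet v r τ₁ τ₂, ENNReal.ofReal (lam ^ n) *
          ENNReal.ofReal |(fderiv ℝ (legendreMap v) X).det| :=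
        (lintegral_const_mul' _ _ ENNReal.ofReal_ne_top).symm
    _ ≤ _ := by
        refine setLIntegral_mono' hv.measurableSet_contactSet fun X hX => ?_
        rw [← ENNReal.ofReal_mul (by positivity)]
        refine ENNReal.ofReal_le_ofReal ?_
        obtain ⟨-, -, htime, hhess, -⟩ := id hX
        have h3 := Matrix.PosSemidef.pow_mul_det_le_trace_mul_pow hlam (ha X hX) hhess
        have h4 := (ha X hX).trace_mul_nonneg hhess
        have h5 := hF X hX
        have h6 : (a X * -spaceHess v X).trace = - (a X * spaceHess v X).trace := by simp
        have h7 : 0 ≤ (a X * -spaceHess v X).trace := by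
          rw [sub_mul, Matrix.trace_sub, smul_mul_assoc, one_mul, Matrix.trace_smul,
            smul_eq_mul] at h4
          have := mul_nonneg hlam hhess.trace_nonneg
          linarith
        have h8 : |(fderiv ℝ (legendreMap v) X).det| = (-spaceHess v X).det * timeDeriv v X := by
          rw [det_fderiv_legendreMap hv, abs_mul, abs_of_nonneg htime,
            ← abs_of_nonneg hhess.det_nonneg, Matrix.det_neg, abs_mul]
          simp
        have h9 : 0 ≤ F X := by linarith
        rw [h8]
        calc lam ^ n * ((-spaceHess v X).det * timeDeriv v X)
            = (lam ^ n * (-spaceHess v X).det) * timeDeriv v X := by ring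
          _ ≤ (a X * -spaceHess v X).trace ^ n * timeDeriv v X := by gcongr
          _ ≤ F X ^ n * F X := by gcongr <;> linarith
          _ = F X ^ (n + 1) := by ring

end Contact

/-! ### Cutoff functions -/

section Products

variable {n : ℕ} {f g : SpaceTime n → ℝ}

theorem spaceGrad_mul (hf : ContDiff ℝ 2 f) (hg : ContDiff ℝ 2 g) (X : SpaceTime n) :
    spaceGrad (fun Y => f Y * g Y) X = f X • spaceGrad g X + g X • spaceGrad f X := by
  ext i
  simp [spaceGrad, fderiv_fun_mul (hf.differentiable (by norm_num) X)
    (hg.differentiable (by norm_num) X)]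

theorem timeDeriv_mul (hf : ContDiff ℝ 2 f) (hg : ContDiff ℝ 2 g) (X : SpaceTime n) :
    timeDeriv (fun Y => f Y * g Y) X = f X * timeDeriv g X + g X * timeDeriv f X := by
  simp [timeDeriv, fderiv_fun_mul (hf.differentiable (by norm_num) X)
    (hg.differentiable (by norm_num) X)]

theorem spaceHess_mul (hf : ContDiff ℝ 2 f) (hg : ContDiff ℝ 2 g) (X : SpaceTime n) (i j : Fin n) :
    spaceHess (fun Y => f Y * g Y) X i j = f X * spaceHess g X i j +
      (spaceGrad f X j * spaceGrad g X i + spaceGrad f X i * spaceGrad g X j) +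
      g X * spaceHess f X i j := by
  have hfd := hf.differentiable (by norm_num)
  have hgd := hg.differentiable (by norm_num)
  have h1 : (fun Y => fderiv ℝ (fun Y => f Y * g Y) Y (spaceDir i)) =
      fun Y => f Y * fderiv ℝ g Y (spaceDir i) + g Y * fderiv ℝ f Y (spaceDir i) := by
    funext Y
    simp [fderiv_fun_mul (hfd Y) (hgd Y)]
  have hf' := (hf.fderiv_apply_const (spaceDir i)).differentiable (by norm_num) X
  have hg' := (hg.fderiv_apply_const (spaceDir i)).differentiable (by norm_num) X
  simp only [spaceHess]
  rw [h1, fderiv_fun_add ((hfd X).fun_mul hg') ((hgd X).fun_mul hf'), fderiv_fun_mul (hfd X) hg',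
    fderiv_fun_mul (hgd X) hf']
  simp [spaceGrad]
  ring

theorem spaceGrad_pow (hf : ContDiff ℝ 2 f) (m : ℕ) (X : SpaceTime n) :
    spaceGrad (fun Y => f Y ^ m) X = (m * f X ^ (m - 1)) • spaceGrad f X := by
  ext i
  simp [spaceGrad, fderiv_fun_pow m (hf.differentiable (by norm_num) X)]

theorem timeDeriv_pow (hf : ContDiff ℝ 2 f) (m : ℕ) (X : SpaceTime n) :
    timeDeriv (fun Y => f Y ^ m) X = (m * f X ^ (m - 1)) * timeDeriv f X := by
  simp [timeDeriv, fderiv_fun_pow m (hf.differentiable (by norm_num) X)]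

theorem spaceHess_pow (hf : ContDiff ℝ 2 f) (m : ℕ) (X : SpaceTime n) (i j : Fin n) :
    spaceHess (fun Y => f Y ^ (m + 2)) X i j =
      ((m + 2) * (m + 1) * f X ^ m) * (spaceGrad f X i * spaceGrad f X j) +
      ((m + 2) * f X ^ (m + 1)) * spaceHess f X i j := by
  have h1 : (fun Y => fderiv ℝ (fun Y => f Y ^ (m + 2)) Y (spaceDir i)) =
      fun Y => ((m + 2 : ℝ) * f Y ^ (m + 1)) * fderiv ℝ f Y (spaceDir i) := by
    funext Y
    simp [fderiv_fun_pow (m + 2) (hf.differentiable (by norm_num) Y)]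
  have hfd := hf.differentiable (by norm_num) X
  have hf' := (hf.fderiv_apply_const (spaceDir i)).differentiable (by norm_num) X
  simp only [spaceHess]
  rw [h1, fderiv_fun_mul ((hfd.fun_pow (m + 1)).const_mul _) hf',
    fderiv_const_mul (hfd.fun_pow (m + 1)), fderiv_fun_pow (m + 1) hfd]
  simp [spaceGrad]
  ring

end Products

/-- The cutoff `(1 - |x|² / r²) (t - τ₁) / T`, which vanishes on the parabolic boundary of
`B_r × (τ₁, τ₂)`. -/
noncomputable def cutoff {n : ℕ} (r τ₁ T : ℝ) (X : SpaceTime n) : ℝ :=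
  (1 - ‖X.1‖ ^ 2 / r ^ 2) * ((X.2 - τ₁) / T)

section Cutoff

variable {n : ℕ} {r τ₁ T : ℝ}

theorem contDiff_cutoff : ContDiff ℝ 2 (cutoff r τ₁ T : SpaceTime n → ℝ) := by
  unfold cutoff
  exact (contDiff_const.sub ((contDiff_fst.norm_sq ℝ).div_const _)).mul
    ((contDiff_snd.sub contDiff_const).div_const _)

theorem fderiv_cutoff_apply (X Z : SpaceTime n) :
    fderiv ℝ (cutoff r τ₁ T) X Z = (1 - ‖X.1‖ ^ 2 / r ^ 2) * (Z.2 / T) -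
      (X.2 - τ₁) / T * (2 * inner ℝ X.1 Z.1 / r ^ 2) := by
  have h1 : HasFDerivAt (fun Y : SpaceTime n => ‖Y.1‖ ^ 2) _ X :=
    (hasFDerivAt_fst (𝕜 := ℝ) (p := X)).norm_sq
  have h2 : HasFDerivAt (fun Y : SpaceTime n => Y.2) _ X := hasFDerivAt_snd (𝕜 := ℝ)
  have h3 := ((h1.mul_const (r ^ 2)⁻¹).const_sub 1).mul ((h2.sub_const τ₁).mul_const T⁻¹)
  have h4 := h3.fderiv
  change fderiv ℝ (cutoff r τ₁ T) X = _ at h4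
  rw [h4]
  simp
  ring

theorem spaceGrad_cutoff (X : SpaceTime n) :
    spaceGrad (cutoff r τ₁ T) X = (-(2 * ((X.2 - τ₁) / T) / r ^ 2)) • X.1 := by
  ext i
  simp [spaceGrad, fderiv_cutoff_apply, spaceDir, EuclideanSpace.inner_single_right]
  ring

theorem timeDeriv_cutoff (X : SpaceTime n) :
    timeDeriv (cutoff r τ₁ T) X = (1 - ‖X.1‖ ^ 2 / r ^ 2) / T := by
  simp [timeDeriv, fderiv_cutoff_apply, timeDir]
  ring

theorem spaceHess_cutoff (X : SpaceTime n) (i j : Fin n) :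
    spaceHess (cutoff r τ₁ T) X i j =
      -(2 * ((X.2 - τ₁) / T) / r ^ 2) * (1 : Matrix (Fin n) (Fin n) ℝ) i j := by
  have h1 : (fun Y : SpaceTime n => fderiv ℝ (cutoff r τ₁ T) Y (spaceDir i)) =
      fun Y => (-(2 / T / r ^ 2)) * ((Y.2 - τ₁) * Y.1 i) := by
    funext Y
    simp [fderiv_cutoff_apply, spaceDir, EuclideanSpace.inner_single_right]
    ring
  have h2 : HasFDerivAt (fun Y : SpaceTime n => Y.2) _ X := hasFDerivAt_snd (𝕜 := ℝ)
  have h3 : HasFDerivAt (fun Y : SpaceTime n => Y.1 i) _ X :=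
    (PiLp.hasFDerivAt_apply (𝕜 := ℝ) 2 X.1 i).comp X (hasFDerivAt_fst (𝕜 := ℝ) (p := X))
  have h4 := (((h2.sub_const τ₁).fun_mul h3).const_mul (-(2 / T / r ^ 2))).fderiv
  simp only [spaceHess]
  rw [h1, h4]
  by_cases hij : i = j
  · subst hij
    simp [spaceDir]
    ring
  · simp [spaceDir, hij]

theorem cutoff_le (hr : 0 < r) (hT : 0 < T) {X : SpaceTime n} (hx : ‖X.1‖ < r)
    (ht : τ₁ < X.2) (ht' : X.2 - τ₁ ≤ T) :
    0 < cutoff r τ₁ T X ∧ cutoff r τ₁ T X ≤ 1 ∧ r * cutoff r τ₁ T X ≤ 2 * (r - ‖X.1‖) := by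
  have h0 := norm_nonneg X.1
  have h1 : ‖X.1‖ ^ 2 / r ^ 2 < 1 := by
    rw [div_lt_one (by positivity)]
    gcongr
  have h2 : 0 < (X.2 - τ₁) / T := div_pos (by linarith) hT
  have h3 : (X.2 - τ₁) / T ≤ 1 := by rwa [div_le_one hT]
  have h4 : 0 ≤ ‖X.1‖ ^ 2 / r ^ 2 := by positivity
  have h5 : cutoff r τ₁ T X ≤ 1 - ‖X.1‖ ^ 2 / r ^ 2 := by
    unfold cutoff
    exact mul_le_of_le_one_right (by linarith) h3
  refine ⟨mul_pos (by linarith) h2, by linarith, ?_⟩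
  calc r * cutoff r τ₁ T X ≤ r * (1 - ‖X.1‖ ^ 2 / r ^ 2) := by gcongr
    _ = 2 * (r - ‖X.1‖) - (r - ‖X.1‖) ^ 2 / r := by field_simp; ring
    _ ≤ 2 * (r - ‖X.1‖) := by
      have : 0 ≤ (r - ‖X.1‖) ^ 2 / r := by positivity
      linarith

end Cutoff

theorem EuclideanSpace.dotProduct_self {n : ℕ} (x : EuclideanSpace ℝ (Fin n)) :
    x.ofLp ⬝ᵥ x.ofLp = ‖x‖ ^ 2 := by
  rw [EuclideanSpace.real_norm_sq_eq]
  simp [dotProduct, sq]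

theorem EuclideanSpace.sum_mul_le {n : ℕ} (x y : EuclideanSpace ℝ (Fin n)) :
    ∑ i, x i * y i ≤ ‖x‖ * ‖y‖ := by
  have := real_inner_le_norm x y
  simpa [PiLp.inner_apply, mul_comm] using this

open Matrix in
theorem Matrix.trace_mul_spaceHess_cutoff_pow_mul {n : ℕ} {r τ₁ T : ℝ} {u : SpaceTime n → ℝ}
    (hu : ContDiff ℝ 2 u) {A : Matrix (Fin n) (Fin n) ℝ} (hA : A.IsSymm) (m : ℕ)
    (X : SpaceTime n) :
    (A * spaceHess (fun Y => cutoff r τ₁ T Y ^ (m + 2) * u Y) X).trace =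
      cutoff r τ₁ T X ^ (m + 2) * (∑ i, ∑ j, A i j * spaceHess u X i j) +
      2 * (m + 2) * cutoff r τ₁ T X ^ (m + 1) *
        ((spaceGrad (cutoff r τ₁ T) X).ofLp ⬝ᵥ A *ᵥ (spaceGrad u X).ofLp) +
      u X * ((m + 2) * (m + 1) * cutoff r τ₁ T X ^ m *
        ((spaceGrad (cutoff r τ₁ T) X).ofLp ⬝ᵥ A *ᵥ (spaceGrad (cutoff r τ₁ T) X).ofLp) -
        2 * (m + 2) * cutoff r τ₁ T X ^ (m + 1) * ((X.2 - τ₁) / T / r ^ 2) * A.trace) := by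
  set ζ := cutoff r τ₁ T X with hζ
  set z := spaceGrad (cutoff r τ₁ T) X with hz
  set w := spaceGrad u X with hw
  have hsymm : w.ofLp ⬝ᵥ A *ᵥ z.ofLp = z.ofLp ⬝ᵥ A *ᵥ w.ofLp := by
    rw [Matrix.dotProduct_mulVec, ← Matrix.mulVec_transpose, hA.eq, dotProduct_comm]
  have hv2 : ContDiff ℝ 2 (fun Y => cutoff r τ₁ T Y ^ (m + 2) * u Y) :=
    (contDiff_cutoff.pow _).mul hu
  have htr : ∀ N : Matrix (Fin n) (Fin n) ℝ, N.IsSymm →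
      (A * N).trace = ∑ i, ∑ j, A i j * N i j := by
    intro N hN
    simp only [Matrix.trace, Matrix.diag, Matrix.mul_apply]
    exact Finset.sum_congr rfl fun i _ => Finset.sum_congr rfl fun j _ => by rw [hN.apply]
  have hone : ∑ i, ∑ j, A i j * (1 : Matrix (Fin n) (Fin n) ℝ) i j = A.trace := by
    rw [← htr _ Matrix.isSymm_one, mul_one]
  have hq : ∀ x y : Fin n → ℝ, ∑ i, ∑ j, A i j * (x i * y j) = x ⬝ᵥ A *ᵥ y := by
    intro x y
    simp only [dotProduct, Matrix.mulVec, Finset.mul_sum]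
    exact Finset.sum_congr rfl fun i _ => Finset.sum_congr rfl fun j _ => by ring
  rw [htr _ (hv2.isSymm_spaceHess X)]
  have hentry : ∀ i j, A i j * spaceHess (fun Y => cutoff r τ₁ T Y ^ (m + 2) * u Y) X i j =
      ζ ^ (m + 2) * (A i j * spaceHess u X i j) +
      ((m + 2) * ζ ^ (m + 1)) * (A i j * (w i * z j)) +
      ((m + 2) * ζ ^ (m + 1)) * (A i j * (z i * w j)) +
      (u X * ((m + 2) * (m + 1) * ζ ^ m)) * (A i j * (z i * z j)) +
      (-(u X * (2 * (m + 2) * ζ ^ (m + 1) * ((X.2 - τ₁) / T / r ^ 2)))) *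
        (A i j * (1 : Matrix (Fin n) (Fin n) ℝ) i j) := by
    intro i j
    rw [spaceHess_mul (contDiff_cutoff.pow _) hu, spaceHess_pow contDiff_cutoff,
      spaceGrad_pow contDiff_cutoff, spaceHess_cutoff]
    have hsub : m + 2 - 1 = m + 1 := rfl
    simp only [← hζ, ← hz, ← hw, PiLp.smul_apply, smul_eq_mul, hsub]
    push_cast
    ring
  simp only [hentry, Finset.sum_add_distrib, ← Finset.mul_sum, hq, hone, hsymm]
  ring

/-- The constant of the differential inequality for `cutoff ^ (m + 2) * u`. -/
def cutoffConst (n m : ℕ) : ℝ :=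
  4 * (m + 2) * ((m + 3) ^ 2 + 1) + 2 * (m + 2) * n

open Matrix in
/-- The differential inequality for `v = cutoff ^ (m + 2) * u` on its contact set. There the bound
`|Dv| (r - |x|) ≤ v` lets the cutoff absorb the gradient of `u`: one has
`cutoff * |Du| ≤ C u / r`. -/
theorem timeDeriv_sub_trace_le_of_mem_contactSet {n : ℕ} {r τ₁ τ₂ T : ℝ} {u : SpaceTime n → ℝ}
    (hu : ContDiff ℝ 2 u) (hr : 0 < r) (hT : 0 < T) (hτ : τ₂ - τ₁ ≤ T) (m : ℕ) {X : SpaceTime n}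
    (hX : X ∈ contactSet (fun Y => cutoff r τ₁ T Y ^ (m + 2) * u Y) r τ₁ τ₂)
    {A : Matrix (Fin n) (Fin n) ℝ} {Lam B c c₀ : ℝ} {b : EuclideanSpace ℝ (Fin n)}
    (hA : A.PosSemidef) (hLam : (Lam • (1 : Matrix (Fin n) (Fin n) ℝ) - A).PosSemidef)
    (hLam0 : 0 ≤ Lam) (hb : ‖b‖ ≤ B) (hc : c ≤ c₀) (hc₀ : 0 ≤ c₀) :
    timeDeriv (fun Y => cutoff r τ₁ T Y ^ (m + 2) * u Y) X -
        (A * spaceHess (fun Y => cutoff r τ₁ T Y ^ (m + 2) * u Y) X).trace ≤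
      max (-(-timeDeriv u X + ∑ i, ∑ j, A i j * spaceHess u X i j +
        ∑ i, b i * spaceGrad u X i + c * u X)) 0 +
      cutoffConst n m * (c₀ + B / r + Lam / r ^ 2 + 1 / T) * (cutoff r τ₁ T X ^ m * u X) := by
  obtain ⟨⟨hx, ht1, ht2⟩, hvpos, -, -, hgrad⟩ := hX
  have hx' : ‖X.1‖ < r := by simpa using hx
  obtain ⟨hζ0, hζ1, hζr⟩ := cutoff_le hr hT hx' ht1 (by linarith : X.2 - τ₁ ≤ T)
  have hAs : A.IsSymm := by simpa [Matrix.IsHermitian, Matrix.IsSymm] using hA.1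
  rw [Matrix.trace_mul_spaceHess_cutoff_pow_mul hu hAs,
    timeDeriv_mul (contDiff_cutoff.pow _) hu, timeDeriv_pow contDiff_cutoff, timeDeriv_cutoff]
  rw [spaceGrad_mul (contDiff_cutoff.pow _) hu, spaceGrad_pow contDiff_cutoff] at hgrad
  have hz : ‖spaceGrad (cutoff r τ₁ T) X‖ ≤ 2 / r := by
    have h2 : 0 < (X.2 - τ₁) / T := div_pos (by linarith) hT
    have h3 : (X.2 - τ₁) / T ≤ 1 := by rw [div_le_one hT]; linarith
    rw [spaceGrad_cutoff, norm_smul, norm_neg, Real.norm_of_nonneg (by positivity)]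
    calc 2 * ((X.2 - τ₁) / T) / r ^ 2 * ‖X.1‖ ≤ 2 * 1 / r ^ 2 * r := by gcongr
      _ = 2 / r := by field_simp
  set ζ := cutoff r τ₁ T X with hζ
  set z := spaceGrad (cutoff r τ₁ T) X with hzdef
  set w := spaceGrad u X with hw
  set U := u X with hU
  set τ := (X.2 - τ₁) / T with hτdef
  have hτ0 : 0 ≤ τ := div_nonneg (by linarith) hT.le
  have hτ1 : τ ≤ 1 := by rw [hτdef, div_le_one hT]; linarith
  have hB : 0 ≤ B := (norm_nonneg _).trans hb
  have hU0 : 0 < U := pos_of_mul_pos_right hvpos (by positivity)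
  have hsub : m + 2 - 1 = m + 1 := rfl
  simp only [hsub] at hgrad ⊢
  -- the gradient of `u` is controlled by `u / (r ζ)`
  have hw' : ζ * ‖w‖ ≤ 2 * (m + 3) / r * U := by
    set p := ζ ^ (m + 2) • w + U • (((m + 2 : ℕ) : ℝ) * ζ ^ (m + 1)) • z with hp
    have h1 : ‖p‖ ≤ 2 / r * ζ ^ (m + 1) * U := by
      have h3 : ‖p‖ * (r * ζ / 2) ≤ ζ ^ (m + 2) * U :=
        le_trans (by gcongr; linarith) hgrad
      have h4 : ‖p‖ = (‖p‖ * (r * ζ / 2)) * (2 / (r * ζ)) := by field_simp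
      rw [h4]
      calc _ ≤ (ζ ^ (m + 2) * U) * (2 / (r * ζ)) := by gcongr
        _ = _ := by field_simp; ring
    have h2 : ζ ^ (m + 2) • w = p - U • (((m + 2 : ℕ) : ℝ) * ζ ^ (m + 1)) • z := by
      rw [hp]; abel
    have h3 : ζ ^ (m + 2) * ‖w‖ ≤ ‖p‖ + U * ((m + 2) * ζ ^ (m + 1)) * ‖z‖ := by
      have := norm_sub_le p (U • (((m + 2 : ℕ) : ℝ) * ζ ^ (m + 1)) • z)
      rw [← h2, norm_smul, norm_smul, norm_smul, Real.norm_of_nonneg (by positivity),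
        Real.norm_of_nonneg hU0.le, Real.norm_of_nonneg (by positivity)] at this
      push_cast at this
      linarith
    have h4 : ζ ^ (m + 1) * (ζ * ‖w‖) ≤ ζ ^ (m + 1) * (2 * (m + 3) / r * U) := by
      calc ζ ^ (m + 1) * (ζ * ‖w‖) = ζ ^ (m + 2) * ‖w‖ := by ring
        _ ≤ ‖p‖ + U * ((m + 2) * ζ ^ (m + 1)) * ‖z‖ := h3
        _ ≤ 2 / r * ζ ^ (m + 1) * U + U * ((m + 2) * ζ ^ (m + 1)) * (2 / r) := by gcongr
        _ = _ := by ring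
    exact le_of_mul_le_mul_left h4 (by positivity)
  have hbw : ∑ i, b i * w i ≤ B * ‖w‖ :=
    (EuclideanSpace.sum_mul_le b w).trans (by gcongr)
  have hcross : -(2 * ζ * (z.ofLp ⬝ᵥ A *ᵥ w.ofLp)) ≤ Lam * (4 * ((m + 3) ^ 2 + 1)) / r ^ 2 * U := by
    have h1 := hA.abs_dotProduct_mulVec_le hLam (U • z.ofLp) (ζ • w.ofLp)
    simp only [mulVec_smul, smul_dotProduct, dotProduct_smul, smul_eq_mul,
      EuclideanSpace.dotProduct_self] at h1
    rw [mul_left_comm ζ U] at h1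
    have h2 := neg_abs_le (U * (ζ * (z.ofLp ⬝ᵥ A *ᵥ w.ofLp)))
    have h3 : U * (U * ‖z‖ ^ 2) + ζ * (ζ * ‖w‖ ^ 2) ≤
        U ^ 2 * (4 * ((m + 3) ^ 2 + 1)) / r ^ 2 := by
      calc U * (U * ‖z‖ ^ 2) + ζ * (ζ * ‖w‖ ^ 2) = U ^ 2 * ‖z‖ ^ 2 + (ζ * ‖w‖) ^ 2 := by ring
        _ ≤ U ^ 2 * (2 / r) ^ 2 + (2 * (m + 3) / r * U) ^ 2 := by gcongr
        _ = _ := by field_simp; ring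
    have h4 : U * (-(2 * ζ * (z.ofLp ⬝ᵥ A *ᵥ w.ofLp))) ≤
        U * (Lam * (4 * ((m + 3) ^ 2 + 1)) / r ^ 2 * U) := by
      calc _ = -(2 * (U * (ζ * (z.ofLp ⬝ᵥ A *ᵥ w.ofLp)))) := by ring
        _ ≤ Lam * (U * (U * ‖z‖ ^ 2) + ζ * (ζ * ‖w‖ ^ 2)) := by linarith
        _ ≤ Lam * (U ^ 2 * (4 * ((m + 3) ^ 2 + 1)) / r ^ 2) := by gcongr
        _ = _ := by ring
    exact le_of_mul_le_mul_left h4 hU0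
  have hzz : 0 ≤ z.ofLp ⬝ᵥ A *ᵥ z.ofLp := by simpa using hA.dotProduct_mulVec_nonneg z.ofLp
  have htrA : A.trace ≤ n * Lam := Matrix.trace_le_of_posSemidef_smul_one_sub hLam
  have htrA0 : 0 ≤ A.trace := hA.trace_nonneg
  set g := -timeDeriv u X + ∑ i, ∑ j, A i j * spaceHess u X i j + ∑ i, b i * w i + c * U with hg
  set P := ζ ^ m * U with hP
  have hP0 : 0 ≤ P := by positivity
  have t1 : ζ ^ (m + 2) * -g ≤ max (-g) 0 := by
    calc ζ ^ (m + 2) * -g ≤ ζ ^ (m + 2) * max (-g) 0 := by gcongr; exact le_max_left _ _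
      _ ≤ 1 * max (-g) 0 := by
        have := le_max_right (-g) 0
        gcongr
        exact pow_le_one₀ hζ0.le hζ1
      _ = _ := one_mul _
  have t2 : ζ ^ (m + 2) * ∑ i, b i * w i ≤ (2 * (m + 3)) * (B / r) * P := by
    calc ζ ^ (m + 2) * ∑ i, b i * w i ≤ ζ ^ (m + 2) * (B * ‖w‖) := by gcongr
      _ = ζ * (ζ ^ m * B * (ζ * ‖w‖)) := by ring
      _ ≤ 1 * (ζ ^ m * B * (2 * (m + 3) / r * U)) := by gcongr
      _ = _ := by rw [hP]; ring
  have t3 : ζ ^ (m + 2) * (c * U) ≤ c₀ * P := by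
    calc ζ ^ (m + 2) * (c * U) ≤ ζ ^ (m + 2) * (c₀ * U) := by gcongr
      _ = ζ ^ 2 * (ζ ^ m * (c₀ * U)) := by ring
      _ ≤ 1 * (ζ ^ m * (c₀ * U)) := by gcongr; exact pow_le_one₀ hζ0.le hζ1
      _ = _ := by rw [hP]; ring
  have t4 : U * (((m + 2 : ℕ) : ℝ) * ζ ^ (m + 1) * ((1 - ‖X.1‖ ^ 2 / r ^ 2) / T)) ≤
      (m + 2) * (1 / T) * P := by
    have : (1 - ‖X.1‖ ^ 2 / r ^ 2) / T ≤ 1 / T := by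
      gcongr
      have : 0 ≤ ‖X.1‖ ^ 2 / r ^ 2 := by positivity
      linarith
    calc _ ≤ U * (((m + 2 : ℕ) : ℝ) * ζ ^ (m + 1) * (1 / T)) := by gcongr
      _ = ζ * (U * ((m + 2) * ζ ^ m * (1 / T))) := by push_cast; ring
      _ ≤ 1 * (U * ((m + 2) * ζ ^ m * (1 / T))) := by gcongr
      _ = _ := by rw [hP]; ring
  have t5 : -(2 * (m + 2) * ζ ^ (m + 1) * (z.ofLp ⬝ᵥ A *ᵥ w.ofLp)) ≤
      4 * (m + 2) * ((m + 3) ^ 2 + 1) * (Lam / r ^ 2) * P := by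
    calc _ = ((m + 2) * ζ ^ m) * (-(2 * ζ * (z.ofLp ⬝ᵥ A *ᵥ w.ofLp))) := by ring
      _ ≤ ((m + 2) * ζ ^ m) * (Lam * (4 * ((m + 3) ^ 2 + 1)) / r ^ 2 * U) := by gcongr
      _ = _ := by rw [hP]; ring
  have t6 : 0 ≤ U * ((m + 2) * (m + 1) * ζ ^ m * (z.ofLp ⬝ᵥ A *ᵥ z.ofLp)) := by positivity
  have t7 : U * (2 * (m + 2) * ζ ^ (m + 1) * (τ / r ^ 2) * A.trace) ≤
      2 * (m + 2) * n * (Lam / r ^ 2) * P := by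
    calc _ = ζ * τ * (U * (2 * (m + 2) * ζ ^ m * (1 / r ^ 2) * A.trace)) := by ring
      _ ≤ 1 * 1 * (U * (2 * (m + 2) * ζ ^ m * (1 / r ^ 2) * (n * Lam))) := by gcongr
      _ = _ := by rw [hP]; ring
  have k4 : (4 * (m + 2) : ℝ) ≤ cutoffConst n m := by
    have h1 : (4 * (m + 2) * 1 : ℝ) ≤ 4 * (m + 2) * ((m + 3) ^ 2 + 1) := by
      gcongr
      exact le_add_of_nonneg_left (by positivity)
    have h2 : (0 : ℝ) ≤ 2 * (m + 2) * n := by positivity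
    unfold cutoffConst
    linarith
  have k1 : (0 : ℝ) ≤ m := Nat.cast_nonneg m
  have s2 : (2 * (m + 3)) * (B / r) * P ≤ cutoffConst n m * (B / r) * P := by
    gcongr
    linarith
  have s3 : 1 * c₀ * P ≤ cutoffConst n m * c₀ * P := by
    gcongr
    linarith
  have s4 : (m + 2) * (1 / T) * P ≤ cutoffConst n m * (1 / T) * P := by
    gcongr
    linarith
  have s5 : 4 * (m + 2) * ((m + 3) ^ 2 + 1) * (Lam / r ^ 2) * P +
      2 * (m + 2) * n * (Lam / r ^ 2) * P = cutoffConst n m * (Lam / r ^ 2) * P := by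
    unfold cutoffConst; ring
  calc _ = ζ ^ (m + 2) * -g + ζ ^ (m + 2) * ∑ i, b i * w i + ζ ^ (m + 2) * (c * U) +
        U * (((m + 2 : ℕ) : ℝ) * ζ ^ (m + 1) * ((1 - ‖X.1‖ ^ 2 / r ^ 2) / T)) +
        -(2 * (m + 2) * ζ ^ (m + 1) * (z.ofLp ⬝ᵥ A *ᵥ w.ofLp)) -
        U * ((m + 2) * (m + 1) * ζ ^ m * (z.ofLp ⬝ᵥ A *ᵥ z.ofLp)) +
        U * (2 * (m + 2) * ζ ^ (m + 1) * (τ / r ^ 2) * A.trace) := by rw [hg]; ring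
    _ ≤ max (-g) 0 + (2 * (m + 3)) * (B / r) * P + 1 * c₀ * P + (m + 2) * (1 / T) * P +
        4 * (m + 2) * ((m + 3) ^ 2 + 1) * (Lam / r ^ 2) * P - 0 +
        2 * (m + 2) * n * (Lam / r ^ 2) * P := by
      rw [one_mul]
      gcongr
    _ ≤ max (-g) 0 + cutoffConst n m * (B / r) * P + cutoffConst n m * c₀ * P +
        cutoffConst n m * (1 / T) * P + cutoffConst n m * (Lam / r ^ 2) * P := by
      linarith only [s2, s3, s4, s5]
    _ = _ := by ring

/-! ### The cutoff estimate in integral form -/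

/-- Absorption: in `M ≤ a + b M ^ (1 - 1 / k) N ^ (1 / k)` one of the two terms on the right is at
least `M / 2`. -/
theorem le_of_le_add_mul_rpow {M a b N : ℝ} {k : ℕ} (hk : k ≠ 0) (hM : 0 < M) (ha : 0 ≤ a)
    (hb : 0 ≤ b) (hN : 0 ≤ N)
    (h : M ≤ a + b * (M ^ (1 - 1 / (k : ℝ)) * N ^ (1 / (k : ℝ)))) :
    M ≤ 2 * a + (2 * b) ^ k * N := by
  rcases le_total (M / 2) a with h1 | h1
  · have : 0 ≤ (2 * b) ^ k * N := by positivity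
    linarith
  · have h2 : M ≤ 2 * b * (M ^ (1 - 1 / (k : ℝ)) * N ^ (1 / (k : ℝ))) := by linarith
    have hk' : (k : ℝ) ≠ 0 := by exact_mod_cast hk
    have h3 : M ^ (1 - 1 / (k : ℝ)) * M ^ (1 / (k : ℝ)) = M := by
      rw [← Real.rpow_add hM]; simp
    have h4 : M ^ (1 / (k : ℝ)) ≤ 2 * b * N ^ (1 / (k : ℝ)) := by
      refine le_of_mul_le_mul_left ?_ (Real.rpow_pos_of_pos hM (1 - 1 / (k : ℝ)))
      rw [h3]
      linarith
    have h5 : M ≤ (2 * b) ^ k * N := by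
      calc M = (M ^ (1 / (k : ℝ))) ^ k := by
            rw [← Real.rpow_natCast, ← Real.rpow_mul hM.le]; simp [hk']
        _ ≤ (2 * b * N ^ (1 / (k : ℝ))) ^ k := by gcongr
        _ = (2 * b) ^ k * N := by
            rw [mul_pow, ← Real.rpow_natCast (N ^ _), ← Real.rpow_mul hN]; simp [hk']
    linarith

/-- Interpolation of the cutoff factor: `ζ ^ (2 k - 2) u` is the geometric mean of
`ζ ^ (2 k) u ≤ M` and `u`, with weights `1 - 1 / k` and `1 / k`. -/
theorem pow_mul_le_rpow_mul_rpow {ζ U M : ℝ} (hζ : 0 < ζ) (hU : 0 < U) (l : ℕ)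
    (h : ζ ^ (2 * l + 2) * U ≤ M) :
    ζ ^ (2 * l) * U ≤ M ^ (1 - 1 / ((l + 1 : ℕ) : ℝ)) * U ^ (1 / ((l + 1 : ℕ) : ℝ)) := by
  have hk : ((l + 1 : ℕ) : ℝ) ≠ 0 := by positivity
  have h0 : (0 : ℝ) ≤ 1 - 1 / ((l + 1 : ℕ) : ℝ) := by
    rw [sub_nonneg, div_le_one (by positivity)]
    push_cast
    linarith [(Nat.cast_nonneg l : (0 : ℝ) ≤ l)]
  have e1 : (ζ ^ (2 * l + 2) * U) ^ (1 - 1 / ((l + 1 : ℕ) : ℝ)) * U ^ (1 / ((l + 1 : ℕ) : ℝ)) =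
      ζ ^ (2 * l) * U := by
    rw [Real.mul_rpow (by positivity) hU.le, mul_assoc, ← Real.rpow_add hU, sub_add_cancel,
      Real.rpow_one, ← Real.rpow_natCast, ← Real.rpow_mul hζ.le, ← Real.rpow_natCast]
    congr 2
    push_cast at hk ⊢
    field_simp
    ring
  rw [← e1]
  gcongr

/-- The function `Lu` for a twice differentiable `u`. -/
noncomputable def ParabolicCoeffs.apply {n : ℕ} (L : ParabolicCoeffs n) (u : SpaceTime n → ℝ) :
    SpaceTime n → ℝ :=
  L.op u (timeDeriv u) (fun i X => spaceGrad u X i) (fun i j X => spaceHess u X i j)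

section Bounded

variable {n : ℕ} {L : ParabolicCoeffs n} {Ω : Set (SpaceTime n)} {lam Lam B c₀ : ℝ}
  {X : SpaceTime n}

theorem ParabolicCoeffs.IsBounded.posSemidef_sub (hL : L.IsBounded Ω lam Lam B c₀) (hX : X ∈ Ω) :
    (L.a X - lam • (1 : Matrix (Fin n) (Fin n) ℝ)).PosSemidef :=
  (hL.isSymm X hX).posSemidef_sub_smul_one (hL.le_eigenvalue X hX)

theorem ParabolicCoeffs.IsBounded.posSemidef_smul_one_sub (hL : L.IsBounded Ω lam Lam B c₀)
    (hX : X ∈ Ω) : (Lam • (1 : Matrix (Fin n) (Fin n) ℝ) - L.a X).PosSemidef :=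
  (hL.isSymm X hX).posSemidef_smul_one_sub (hL.eigenvalue_le X hX)

theorem ParabolicCoeffs.IsBounded.posSemidef (hL : L.IsBounded Ω lam Lam B c₀) (hlam : 0 ≤ lam)
    (hX : X ∈ Ω) : (L.a X).PosSemidef := by
  have := (hL.posSemidef_sub hX).add (Matrix.PosSemidef.one.smul hlam)
  rwa [sub_add_cancel] at this

theorem ParabolicCoeffs.IsBounded.le (hL : L.IsBounded Ω lam Lam B c₀) (hn : 1 ≤ n)
    (hX : X ∈ Ω) : lam ≤ Lam := by
  have h := ((hL.posSemidef_sub hX).add (hL.posSemidef_smul_one_sub hX)).diag_nonneg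
    (i := ⟨0, hn⟩)
  simp at h
  linarith

end Bounded

theorem volume_parabolicCylinder {n : ℕ} {R T : ℝ} (hR : 0 < R) :
    volume (parabolicCylinder n R T) =
      ENNReal.ofReal (R ^ n * T) * volume (Metric.ball (0 : EuclideanSpace ℝ (Fin n)) 1) := by
  rw [parabolicCylinder, Measure.volume_eq_prod, Measure.prod_prod,
    Measure.addHaar_ball_of_pos _ _ hR, Real.volume_Ioo, finrank_euclideanSpace_fin,
    ENNReal.ofReal_mul (by positivity), zero_sub, neg_neg]
  ring

/-- The estimate obtained by inserting the differential inequality for `cutoff ^ (2 k) * u` into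
`abp_estimate`, with the powers of the cutoff removed by interpolation. -/
theorem exists_cutoff_max_estimate {n : ℕ} {u : SpaceTime n → ℝ} (hu : ContDiff ℝ 2 u)
    {L : ParabolicCoeffs n} {Ω : Set (SpaceTime n)} {lam Lam B c₀ : ℝ}
    (hL : L.IsBounded Ω lam Lam B c₀) (hlam : 0 ≤ lam) (hLam : 0 ≤ Lam) (hc₀ : 0 ≤ c₀)
    {r τ₁ τ₂ T : ℝ} (hr : 0 < r) (hT : 0 < T) (hτ : τ₂ - τ₁ ≤ T)
    (hQ : Metric.ball (0 : EuclideanSpace ℝ (Fin n)) r ×ˢ Set.Ioc τ₁ τ₂ ⊆ Ω) (l : ℕ)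
    {X₀ : SpaceTime n}
    (hX₀ : X₀ ∈ Metric.ball (0 : EuclideanSpace ℝ (Fin n)) r ×ˢ Set.Ioc τ₁ τ₂)
    (hpos : 0 < u X₀) {G N : ℝ} (hG0 : 0 ≤ G) (hN0 : 0 ≤ N)
    (hG : eLpNorm (fun X => max (-L.apply u X) 0) ((n : ℝ≥0∞) + 1)
      (volume.restrict (Metric.ball (0 : EuclideanSpace ℝ (Fin n)) r ×ˢ Set.Ioc τ₁ τ₂)) ≤
        ENNReal.ofReal G)
    (hN : eLpNorm (fun X => max (u X) 0) (ENNReal.ofReal (((n : ℝ) + 1) / ((l + 1 : ℕ) : ℝ)))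
      (volume.restrict (Metric.ball (0 : EuclideanSpace ℝ (Fin n)) r ×ˢ Set.Ioc τ₁ τ₂)) ≤
        ENNReal.ofReal N) :
    ∃ M : ℝ, cutoff r τ₁ T X₀ ^ (2 * l + 2) * u X₀ ≤ M ∧
      (lam ^ n * ((M / (4 * r)) ^ n * (M / 2)) *
        (volume (Metric.ball (0 : EuclideanSpace ℝ (Fin n)) 1)).toReal) ^ (1 / ((n : ℝ) + 1)) ≤
      G + cutoffConst n (2 * l) * (c₀ + B / r + Lam / r ^ 2 + 1 / T) *
        (M ^ (1 - 1 / ((l + 1 : ℕ) : ℝ)) * N ^ (1 / ((l + 1 : ℕ) : ℝ))) := by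
  set Q := Metric.ball (0 : EuclideanSpace ℝ (Fin n)) r ×ˢ Set.Ioc τ₁ τ₂ with hQdef
  set v : SpaceTime n → ℝ := fun Y => cutoff r τ₁ T Y ^ (2 * l + 2) * u Y with hv
  have hvc : ContDiff ℝ 2 v := (contDiff_cutoff.pow _).mul hu
  set K := Metric.closedBall (0 : EuclideanSpace ℝ (Fin n)) r ×ˢ Set.Icc τ₁ τ₂ with hK
  have hKc : IsCompact K := (isCompact_closedBall 0 r).prod isCompact_Icc
  have hQK : Q ⊆ K := Set.prod_mono Metric.ball_subset_closedBall Set.Ioc_subset_Icc_self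
  have hB : 0 ≤ B := (norm_nonneg _).trans (hL.norm_b_le X₀ (hQ hX₀))
  obtain ⟨X₁, hX₁, hmax⟩ := hKc.exists_isMaxOn ⟨X₀, hQK hX₀⟩ hvc.continuous.continuousOn
  have hvX₀ : 0 < v X₀ := by
    have hx : ‖X₀.1‖ < r := by simpa using hX₀.1
    have := (cutoff_le hr hT hx hX₀.2.1 (by linarith [hX₀.2.2])).1
    positivity
  set M := v X₁ with hM
  have hM0 : 0 < M := hvX₀.trans_le (hmax (hQK hX₀))
  refine ⟨M, hmax (hQK hX₀), ?_⟩
  have hbd : ∀ X ∈ K, (‖X.1‖ = r ∨ X.2 = τ₁) → v X ≤ 0 := by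
    rintro X - (h | h) <;> simp [hv, cutoff, h, hr.ne']
  set C₁ := cutoffConst n (2 * l) * (c₀ + B / r + Lam / r ^ 2 + 1 / T) with hC₁
  have hC₁0 : 0 ≤ C₁ := by
    have : 0 ≤ cutoffConst n (2 * l) := by unfold cutoffConst; positivity
    positivity
  set θ := 1 / ((l + 1 : ℕ) : ℝ) with hθ
  have hθ0 : 0 < θ := by positivity
  set D := C₁ * M ^ (1 - θ) with hD
  have hD0 : 0 ≤ D := by positivity
  set F : SpaceTime n → ℝ := fun X => max (-L.apply u X) 0 + D * max (u X) 0 ^ θ with hF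
  have hcontact : contactSet v r τ₁ τ₂ ⊆ Q := fun X hX => hX.1
  have habp := abp_estimate hvc hr hbd hX₁ hM0 hlam
    (a := L.a) (fun X hX => hL.posSemidef_sub (hQ (hcontact hX))) (F := F) (by
      intro X hX
      have hXΩ := hQ (hcontact hX)
      have h1 := timeDeriv_sub_trace_le_of_mem_contactSet hu hr hT hτ (2 * l) hX
        (hL.posSemidef hlam hXΩ) (hL.posSemidef_smul_one_sub hXΩ) hLam (hL.norm_b_le X hXΩ)
        (hL.c_le X hXΩ) hc₀
      refine h1.trans (add_le_add le_rfl ?_)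
      have hx : ‖X.1‖ < r := by simpa using hX.1.1
      have hζ := (cutoff_le hr hT hx hX.1.2.1 (by linarith [hX.1.2.2])).1
      have hU : 0 < u X := pos_of_mul_pos_right hX.2.1 (by positivity)
      have h2 := pow_mul_le_rpow_mul_rpow hζ hU l (hmax (hQK (hcontact hX)))
      rw [max_eq_left hU.le]
      calc C₁ * (cutoff r τ₁ T X ^ (2 * l) * u X) ≤ C₁ * (M ^ (1 - θ) * u X ^ θ) := by gcongr
        _ = D * u X ^ θ := by rw [hD]; ring)
  have hn1 : (n : ℝ≥0∞) + 1 = ENNReal.ofReal ((n : ℝ) + 1) := by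
    rw [ENNReal.ofReal_add (by positivity) (by norm_num)]; simp
  have hFn : ∫⁻ X in contactSet v r τ₁ τ₂, ENNReal.ofReal (F X ^ (n + 1)) ≤
      eLpNorm F ((n : ℝ≥0∞) + 1) (volume.restrict Q) ^ ((n : ℝ) + 1) := by
    refine (lintegral_mono_set hcontact).trans (le_of_eq ?_)
    rw [hn1, eLpNorm_eq_lintegral_rpow_enorm_toReal (by simp; positivity) ENNReal.ofReal_ne_top,
      ENNReal.toReal_ofReal (by positivity), ← ENNReal.rpow_mul,
      one_div_mul_cancel (by positivity), ENNReal.rpow_one]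
    refine lintegral_congr fun X => ?_
    have hF0 : 0 ≤ F X := by
      have h1 := le_max_right (-L.apply u X) 0
      have h2 := le_max_right (u X) 0
      positivity
    rw [Real.enorm_eq_ofReal hF0, ENNReal.ofReal_rpow_of_nonneg hF0 (by positivity)]
    norm_cast
  have hmeas_g : AEStronglyMeasurable (fun X => max (-L.apply u X) 0) (volume.restrict Q) := by
    have hle : volume.restrict Q ≤ volume.restrict Ω := Measure.restrict_mono hQ le_rfl
    have h1 : AEMeasurable (L.apply u) (volume.restrict Q) := by
      have hH : ∀ i j, AEMeasurable (fun X => spaceHess u X i j) (volume.restrict Q) := fun i j =>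
        (hu.continuous_spaceHess.matrix_elem i j).aemeasurable
      have hg : ∀ i, AEMeasurable (fun X => spaceGrad u X i) (volume.restrict Q) := fun i =>
        (hu.fderiv_apply_const (spaceDir i)).continuous.aemeasurable
      unfold ParabolicCoeffs.apply ParabolicCoeffs.op
      refine ((hu.continuous_timeDeriv.aemeasurable.neg.add ?_).add ?_).add
        ((hL.aemeasurable_c.mono_measure hle).mul hu.continuous.aemeasurable)
      · exact Finset.aemeasurable_fun_sum _ fun i _ => Finset.aemeasurable_fun_sum _ fun j _ =>
          ((hL.aemeasurable_a i j).mono_measure hle).mul (hH i j)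
      · exact Finset.aemeasurable_fun_sum _ fun i _ =>
          ((hL.aemeasurable_b i).mono_measure hle).mul (hg i)
    exact (h1.neg.max aemeasurable_const).aestronglyMeasurable
  have hmeas_u : AEStronglyMeasurable (fun X => D * max (u X) 0 ^ θ) (volume.restrict Q) :=
    (((hu.continuous.max continuous_const).rpow_const fun _ => Or.inr hθ0.le).const_mul
      D).aestronglyMeasurable
  have hnorm_u : eLpNorm (fun X => D * max (u X) 0 ^ θ) ((n : ℝ≥0∞) + 1) (volume.restrict Q) ≤
      ENNReal.ofReal (D * N ^ θ) := by
    have h1 : (fun X => D * max (u X) 0 ^ θ) = D • fun X => ‖max (u X) 0‖ ^ θ := by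
      funext X
      simp [abs_of_nonneg (le_max_right (u X) 0)]
    rw [h1, eLpNorm_const_smul, eLpNorm_norm_rpow _ hθ0, hn1,
      ← ENNReal.ofReal_mul (by positivity), ENNReal.ofReal_mul hD0, Real.enorm_eq_ofReal hD0,
      ← ENNReal.ofReal_rpow_of_nonneg hN0 hθ0.le, hθ, mul_one_div]
    gcongr
  have hnormF : eLpNorm F ((n : ℝ≥0∞) + 1) (volume.restrict Q) ≤ ENNReal.ofReal (G + D * N ^ θ) := by
    rw [ENNReal.ofReal_add hG0 (by positivity)]
    exact (eLpNorm_add_le hmeas_g hmeas_u (by simp)).trans (add_le_add hG hnorm_u)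
  have hω : volume (Metric.ball (0 : EuclideanSpace ℝ (Fin n)) 1) ≠ ⊤ := measure_ball_lt_top.ne
  have hfin : ENNReal.ofReal (lam ^ n * ((M / (4 * r)) ^ n * (M / 2)) *
        (volume (Metric.ball (0 : EuclideanSpace ℝ (Fin n)) 1)).toReal) ≤
      ENNReal.ofReal ((G + D * N ^ θ) ^ ((n : ℝ) + 1)) := by
    rw [ENNReal.ofReal_mul (by positivity), ENNReal.ofReal_toReal hω,
      ← ENNReal.ofReal_rpow_of_nonneg (by positivity) (by positivity)]
    refine (habp.trans hFn).trans ?_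
    gcongr
  have hreal := (ENNReal.ofReal_le_ofReal_iff (by positivity)).1 hfin
  have hS0 : 0 ≤ G + D * N ^ θ := by positivity
  calc _ ≤ ((G + D * N ^ θ) ^ ((n : ℝ) + 1)) ^ (1 / ((n : ℝ) + 1)) := by gcongr
    _ = G + D * N ^ θ := by
      rw [← Real.rpow_mul hS0, mul_one_div_cancel (by positivity), Real.rpow_one]
    _ = _ := by rw [hD]; ring

/-! ### Scaling and the estimate for smooth functions -/

section Scaling

variable {n : ℕ} {R T lam Lam B c₀ : ℝ}

theorem rpow_mul_eq_mul_pow_rpow {x y : ℝ} (hx : 0 ≤ x) (hy : 0 ≤ y) (n : ℕ) :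
    x ^ (1 / ((n : ℝ) + 1)) * y = (x * y ^ (n + 1)) ^ (1 / ((n : ℝ) + 1)) := by
  rw [Real.mul_rpow hx (by positivity), ← Real.rpow_natCast y, ← Real.rpow_mul hy]
  push_cast
  rw [mul_one_div_cancel (by positivity), Real.rpow_one]

theorem parabolicScaleConst_pos (hR : 0 < R) (hT : 0 < T) (hlam : 0 < lam) (hLam : 0 ≤ Lam)
    (hB : 0 ≤ B) (hc₀ : 0 ≤ c₀) : 0 < parabolicScaleConst n R T lam Lam B c₀ := by
  unfold parabolicScaleConst
  positivity

/-- How the scale-invariant constant controls the coefficient of the lower order terms. -/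
theorem rpow_mul_mul_rpow_eq_parabolicScaleConst (hR : 0 < R) (hT : 0 < T) (hlam : 0 < lam) :
    (R ^ n / lam ^ n) ^ (1 / ((n : ℝ) + 1)) * (c₀ + B / R + Lam / R ^ 2 + 1 / T) *
      (R ^ n * T) ^ (1 / ((n : ℝ) + 1)) = parabolicScaleConst n R T lam Lam B c₀ := by
  have h1 : c₀ * R ^ 2 + B * R + Lam + R ^ 2 * T⁻¹ =
      R ^ 2 * (c₀ + B / R + Lam / R ^ 2 + 1 / T) := by field_simp
  have h2 : (R ^ n / lam ^ n) ^ (1 / ((n : ℝ) + 1)) * (R ^ n * T) ^ (1 / ((n : ℝ) + 1)) =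
      ((lam ^ n)⁻¹ * T * (R ^ 2)⁻¹) ^ (1 / ((n : ℝ) + 1)) * R ^ 2 := by
    rw [← Real.mul_rpow (by positivity) (by positivity),
      rpow_mul_eq_mul_pow_rpow (by positivity) (by positivity)]
    congr 1
    simp only [pow_succ, pow_zero, one_mul, mul_pow]
    field_simp
  rw [parabolicScaleConst, h1, ← mul_assoc, ← h2]
  ring

/-- How the scale-invariant constant controls the coefficient of the inhomogeneity; only the
summand `R² / T` of the second factor enters. -/
theorem rpow_le_parabolicScaleConst_mul (hR : 0 < R) (hT : 0 < T) (hlam : 0 < lam)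
    (hLam : 0 ≤ Lam) (hB : 0 ≤ B) (hc₀ : 0 ≤ c₀) :
    (R ^ n / lam ^ n) ^ (1 / ((n : ℝ) + 1)) ≤
      parabolicScaleConst n R T lam Lam B c₀ * (T * R⁻¹) ^ ((n : ℝ) / ((n : ℝ) + 1)) := by
  have h1 : (T * R⁻¹) ^ ((n : ℝ) / ((n : ℝ) + 1)) =
      ((T * R⁻¹) ^ n) ^ (1 / ((n : ℝ) + 1)) := by
    rw [← Real.rpow_natCast, ← Real.rpow_mul (by positivity), mul_one_div]
  have h2 : (R ^ n / lam ^ n) ^ (1 / ((n : ℝ) + 1)) =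
      ((lam ^ n)⁻¹ * T * (R ^ 2)⁻¹) ^ (1 / ((n : ℝ) + 1)) * (R ^ 2 * T⁻¹) *
        (T * R⁻¹) ^ ((n : ℝ) / ((n : ℝ) + 1)) := by
    rw [h1, rpow_mul_eq_mul_pow_rpow (by positivity) (by positivity),
      ← Real.mul_rpow (by positivity) (by positivity)]
    congr 1
    simp only [pow_succ, pow_zero, one_mul, mul_pow, inv_pow]
    field_simp
  rw [h2, parabolicScaleConst]
  gcongr
  have : 0 ≤ c₀ * R ^ 2 + B * R + Lam := by positivity
  linarith

end Scaling

/-- The conclusion about the maximum `M` of `cutoff ^ (2 k) * u`, in scale-invariant form. -/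
theorem cutoff_max_le {n l : ℕ} {R T lam Lam B c₀ r M G N C₁ β : ℝ} (hR : 0 < R)
    (hT : 0 < T) (hlam : 0 < lam) (hLam : 0 ≤ Lam) (hB : 0 ≤ B) (hc₀ : 0 ≤ c₀) (hr : 0 < r)
    (hrR : r ≤ R) (hRr : R ≤ 2 * r) (hM : 0 < M) (hG : 0 ≤ G) (hN : 0 ≤ N) (hC₁ : 0 ≤ C₁)
    (hβ : 0 < β)
    (h : (lam ^ n * ((M / (4 * r)) ^ n * (M / 2)) * β) ^ (1 / ((n : ℝ) + 1)) ≤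
      G + C₁ * (c₀ + B / r + Lam / r ^ 2 + 1 / T) *
        (M ^ (1 - 1 / ((l + 1 : ℕ) : ℝ)) * ((β * (R ^ n * T)) ^
          (((l + 1 : ℕ) : ℝ) / ((n : ℝ) + 1)) * N) ^ (1 / ((l + 1 : ℕ) : ℝ)))) :
    M ≤ 2 * (parabolicScaleConst n R T lam Lam B c₀ /
          (β / (2 * 4 ^ n)) ^ (1 / ((n : ℝ) + 1)) *
          ((T * R⁻¹) ^ ((n : ℝ) / ((n : ℝ) + 1)) * G)) +
      (2 * (4 * C₁ * β ^ (1 / ((n : ℝ) + 1)) * parabolicScaleConst n R T lam Lam B c₀ /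
          (β / (2 * 4 ^ n)) ^ (1 / ((n : ℝ) + 1)))) ^ (l + 1) * N := by
  have hK := parabolicScaleConst_pos (n := n) hR hT hlam hLam hB hc₀
  have hKG := rpow_le_parabolicScaleConst_mul (n := n) hR hT hlam hLam hB hc₀
  have hKΦ := rpow_mul_mul_rpow_eq_parabolicScaleConst (n := n) (Lam := Lam) (B := B) (c₀ := c₀)
    hR hT hlam
  set K := parabolicScaleConst n R T lam Lam B c₀ with hKdef
  set α := 1 / ((n : ℝ) + 1) with hα
  have hα0 : 0 < α := by positivity
  set κ := (β / (2 * 4 ^ n)) ^ α with hκ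
  have hκ0 : 0 < κ := by positivity
  set S := (R ^ n / lam ^ n) ^ α with hS
  have hS0 : 0 < S := by positivity
  set Φ := c₀ + B / R + Lam / R ^ 2 + 1 / T with hΦ
  have hk : ((l + 1 : ℕ) : ℝ) ≠ 0 := by positivity
  set θ := 1 / ((l + 1 : ℕ) : ℝ) with hθ
  have hΦr : c₀ + B / r + Lam / r ^ 2 + 1 / T ≤ 4 * Φ := by
    have h1 : B / r ≤ 2 * (B / R) := by
      calc B / r ≤ B / (R / 2) := by gcongr; linarith
        _ = _ := by field_simp
    have h2 : Lam / r ^ 2 ≤ 4 * (Lam / R ^ 2) := by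
      calc Lam / r ^ 2 ≤ Lam / (R / 2) ^ 2 := by gcongr; linarith
        _ = _ := by field_simp; norm_num
    have h3 : 0 ≤ B / R := by positivity
    have h4 : 0 < 1 / T := by positivity
    rw [hΦ]
    linarith
  have hNθ : ((β * (R ^ n * T)) ^ (((l + 1 : ℕ) : ℝ) / ((n : ℝ) + 1)) * N) ^ θ =
      β ^ α * (R ^ n * T) ^ α * N ^ θ := by
    rw [Real.mul_rpow (by positivity) hN, ← Real.rpow_mul (by positivity),
      ← Real.mul_rpow hβ.le (by positivity)]
    congr 2
    rw [hθ, hα]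
    field_simp
  have hleft : M * κ ≤
      S * (lam ^ n * ((M / (4 * r)) ^ n * (M / 2)) * β) ^ α := by
    have e : M * κ = (R ^ n / lam ^ n * (lam ^ n * ((M / (4 * R)) ^ n * (M / 2)) * β)) ^ α := by
      rw [mul_comm, rpow_mul_eq_mul_pow_rpow (by positivity) hM.le]
      congr 1
      rw [div_pow, mul_pow, pow_succ]
      field_simp
    rw [e, Real.mul_rpow (by positivity) (by positivity)]
    gcongr
  have hkey : M ≤ K / κ * ((T * R⁻¹) ^ ((n : ℝ) / ((n : ℝ) + 1)) * G) +
      4 * C₁ * β ^ α * K / κ * (M ^ (1 - θ) * N ^ θ) := by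
    refine le_of_mul_le_mul_right ?_ hκ0
    have hP : 0 ≤ M ^ (1 - θ) * (β ^ α * (R ^ n * T) ^ α * N ^ θ) := by positivity
    calc M * κ ≤ S * (lam ^ n * ((M / (4 * r)) ^ n * (M / 2)) * β) ^ α := hleft
      _ ≤ S * (G + C₁ * (4 * Φ) * (M ^ (1 - θ) * (β ^ α * (R ^ n * T) ^ α * N ^ θ))) := by
        rw [hNθ] at h
        gcongr
        refine h.trans ?_
        gcongr
      _ = S * G + 4 * C₁ * β ^ α * (S * Φ * (R ^ n * T) ^ α) * (M ^ (1 - θ) * N ^ θ) := by ring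
      _ ≤ K * (T * R⁻¹) ^ ((n : ℝ) / ((n : ℝ) + 1)) * G +
          4 * C₁ * β ^ α * K * (M ^ (1 - θ) * N ^ θ) := by
        rw [hKΦ]
        gcongr
      _ = _ := by field_simp
  exact le_of_le_add_mul_rpow (by simp) hM (by positivity) (by positivity) hN hkey

/-- The local maximum principle for smooth functions, with integrals over a cylinder whose
closure lies in `Ω`, and with `L^q` norms for the exponents `q = (n + 1) / (l + 1)`. -/
theorem exists_interior_estimate_of_contDiff (n : ℕ) (hn : 1 ≤ n) (l : ℕ) {ρ : ℝ} (hρ0 : 0 < ρ)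
    (hρ1 : ρ < 1) (K : ℝ) :
    ∃ C : ℝ, 0 < C ∧
      ∀ (R T lam Lam B c₀ : ℝ), 0 < R → 0 < T → 0 < lam → 0 ≤ c₀ →
        parabolicScaleConst n R T lam Lam B c₀ = K →
      ∀ L : ParabolicCoeffs n, L.IsBounded (parabolicCylinder n R T) lam Lam B c₀ →
      ∀ u : SpaceTime n → ℝ, ContDiff ℝ 2 u →
      ∀ X₀ : SpaceTime n, ‖X₀.1‖ ≤ ρ * R → -(ρ * T) ≤ X₀.2 → X₀.2 < 0 →
        ENNReal.ofReal (u X₀) ≤ ENNReal.ofReal C *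
          (volume (parabolicCylinder n R T) ^ (-(((l + 1 : ℕ) : ℝ) / ((n : ℝ) + 1))) *
              eLpNorm (fun X => max (u X) 0)
                (ENNReal.ofReal (((n : ℝ) + 1) / ((l + 1 : ℕ) : ℝ)))
                (volume.restrict (Metric.ball (0 : EuclideanSpace ℝ (Fin n)) ((1 + ρ) / 2 * R) ×ˢ
                  Set.Ioc (-((1 + ρ) / 2 * T)) X₀.2)) +
            ENNReal.ofReal ((T * R⁻¹) ^ ((n : ℝ) / ((n : ℝ) + 1))) *
              eLpNorm (fun X => max (-L.apply u X) 0) ((n : ℝ≥0∞) + 1)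
                (volume.restrict (Metric.ball (0 : EuclideanSpace ℝ (Fin n)) ((1 + ρ) / 2 * R) ×ˢ
                  Set.Ioc (-((1 + ρ) / 2 * T)) X₀.2))) := by
  rcases le_or_gt K 0 with hK0 | hK0
  · refine ⟨1, one_pos, fun R T lam Lam B c₀ hR hT hlam hc₀ hK L hL => ?_⟩
    have hX : ((0, -(T / 2)) : SpaceTime n) ∈ parabolicCylinder n R T :=
      ⟨by simpa using hR, by constructor <;> simp only <;> linarith⟩
    have := parabolicScaleConst_pos (n := n) hR hT hlam (hlam.le.trans (hL.le hn hX))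
      ((norm_nonneg _).trans (hL.norm_b_le _ hX)) hc₀
    linarith
  set β := (volume (Metric.ball (0 : EuclideanSpace ℝ (Fin n)) 1)).toReal with hβ
  have hβt : volume (Metric.ball (0 : EuclideanSpace ℝ (Fin n)) 1) ≠ ⊤ := measure_ball_lt_top.ne
  have hβ0 : 0 < β := ENNReal.toReal_pos (Metric.measure_ball_pos _ _ one_pos).ne' hβt
  set κ := (β / (2 * 4 ^ n)) ^ (1 / ((n : ℝ) + 1)) with hκ
  have hκ0 : 0 < κ := by positivity
  set a := 2 * (K / κ) with ha
  set b := (2 * (4 * cutoffConst n (2 * l) * β ^ (1 / ((n : ℝ) + 1)) * K / κ)) ^ (l + 1) with hb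
  have hC₁ : 0 ≤ cutoffConst n (2 * l) := by unfold cutoffConst; positivity
  have ha0 : 0 < a := by positivity
  have hb0 : 0 ≤ b := by positivity
  -- the lower bound for the cutoff at `X₀`
  set δ := (1 - ρ ^ 2 / ((1 + ρ) / 2) ^ 2) * ((1 - ρ) / 2) with hδ
  have hδ0 : 0 < δ := by
    refine mul_pos ?_ (by linarith)
    rw [sub_pos, div_lt_one (by positivity)]
    gcongr
    linarith
  refine ⟨(a + b) / δ ^ (2 * l + 2), by positivity, ?_⟩
  intro R T lam Lam B c₀ hR hT hlam hc₀ hK L hL u hu X₀ hx ht1 ht2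
  rcases le_or_gt (u X₀) 0 with hu0 | hu0
  · simp [ENNReal.ofReal_of_nonpos hu0]
  -- the intermediate cylinder ends at the time of `X₀`, where the time factor of the cutoff is
  -- bounded below
  set r := (1 + ρ) / 2 * R with hr
  set τ₁ := -((1 + ρ) / 2 * T) with hτ₁
  set Q := Metric.ball (0 : EuclideanSpace ℝ (Fin n)) r ×ˢ Set.Ioc τ₁ X₀.2 with hQ
  set V := volume (parabolicCylinder n R T) with hV
  have hVeq : V = ENNReal.ofReal (β * (R ^ n * T)) := by
    rw [hV, volume_parabolicCylinder hR, mul_comm β,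
      ENNReal.ofReal_mul (p := R ^ n * T) (by positivity), ENNReal.ofReal_toReal hβt]
  have hV0 : 0 < β * (R ^ n * T) := by positivity
  set Gn := eLpNorm (fun X => max (-L.apply u X) 0) ((n : ℝ≥0∞) + 1) (volume.restrict Q) with hGn
  set Nn := eLpNorm (fun X => max (u X) 0) (ENNReal.ofReal (((n : ℝ) + 1) / ((l + 1 : ℕ) : ℝ)))
    (volume.restrict Q) with hNn
  have hr0 : 0 < r := by positivity
  have hrR : r ≤ R := by
    rw [hr]; exact mul_le_of_le_one_left hR.le (by linarith)
  have hRr : R ≤ 2 * r := by rw [hr]; nlinarith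
  have hQΩ : Q ⊆ parabolicCylinder n R T := by
    refine Set.prod_mono (Metric.ball_subset_ball hrR) fun t ht => ⟨?_, ht.2.trans_lt ht2⟩
    have : (1 + ρ) / 2 * T ≤ T := mul_le_of_le_one_left hT.le (by linarith)
    linarith [ht.1]
  have hX₀Q : X₀ ∈ Q := by
    refine ⟨?_, ?_, le_rfl⟩
    · have : ρ * R < r := by rw [hr]; gcongr; linarith
      simpa using hx.trans_lt this
    · have : ρ * T < (1 + ρ) / 2 * T := by gcongr; linarith
      linarith
  have hX₀Ω := hQΩ hX₀Q
  have hLam : 0 ≤ Lam := hlam.le.trans (hL.le hn hX₀Ω)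
  have hB : 0 ≤ B := (norm_nonneg _).trans (hL.norm_b_le _ hX₀Ω)
  have hτ : X₀.2 - τ₁ ≤ T := by
    have : (1 + ρ) / 2 * T ≤ T := mul_le_of_le_one_left hT.le (by linarith)
    linarith
  have hδle : δ ≤ cutoff r τ₁ T X₀ := by
    have h1 : ‖X₀.1‖ ^ 2 / r ^ 2 ≤ ρ ^ 2 / ((1 + ρ) / 2) ^ 2 := by
      calc ‖X₀.1‖ ^ 2 / r ^ 2 ≤ (ρ * R) ^ 2 / r ^ 2 := by gcongr
        _ = _ := by rw [hr]; field_simp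
    have h2 : (1 - ρ) / 2 ≤ (X₀.2 - τ₁) / T := by
      rw [le_div_iff₀ hT]
      linarith
    have h3 : 0 ≤ 1 - ρ ^ 2 / ((1 + ρ) / 2) ^ 2 := by
      rw [sub_nonneg, div_le_one (by positivity)]
      gcongr
      linarith
    exact mul_le_mul (by linarith) h2 (by linarith) (by linarith)
  have hS0 : 0 < (T * R⁻¹) ^ ((n : ℝ) / ((n : ℝ) + 1)) := by positivity
  have hCpos : ENNReal.ofReal ((a + b) / δ ^ (2 * l + 2)) ≠ 0 := by
    rw [Ne, ENNReal.ofReal_eq_zero, not_le]; positivity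
  have hVp : V ^ (-(((l + 1 : ℕ) : ℝ) / ((n : ℝ) + 1))) =
      ENNReal.ofReal ((β * (R ^ n * T)) ^ (-(((l + 1 : ℕ) : ℝ) / ((n : ℝ) + 1)))) := by
    rw [hVeq, ENNReal.ofReal_rpow_of_pos hV0]
  -- an infinite norm makes the right side infinite
  rcases eq_or_ne Gn ⊤ with hGt | hGt
  · rw [hGt, ENNReal.mul_top (by rw [Ne, ENNReal.ofReal_eq_zero, not_le]; exact hS0), add_top,
      ENNReal.mul_top hCpos]
    exact le_top
  rcases eq_or_ne Nn ⊤ with hNt | hNt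
  · rw [hNt, hVp, ENNReal.mul_top (by rw [Ne, ENNReal.ofReal_eq_zero, not_le]; positivity),
      top_add, ENNReal.mul_top hCpos]
    exact le_top
  obtain ⟨M, hM1, hM2⟩ := exists_cutoff_max_estimate hu hL hlam.le hLam hc₀ hr0 hT hτ hQΩ l hX₀Q hu0
    (G := Gn.toReal) (N := Nn.toReal) ENNReal.toReal_nonneg ENNReal.toReal_nonneg
    (ENNReal.ofReal_toReal hGt).ge (ENNReal.ofReal_toReal hNt).ge
  have hM0 : 0 < M := (mul_pos (pow_pos (hδ0.trans_le hδle) _) hu0).trans_le hM1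
  set G := Gn.toReal with hGdef
  have hG0 : 0 ≤ G := ENNReal.toReal_nonneg
  set N := (β * (R ^ n * T)) ^ (-(((l + 1 : ℕ) : ℝ) / ((n : ℝ) + 1))) * Nn.toReal with hNdef
  have hN0 : 0 ≤ N := mul_nonneg (by positivity) ENNReal.toReal_nonneg
  have hNN : Nn.toReal = (β * (R ^ n * T)) ^ (((l + 1 : ℕ) : ℝ) / ((n : ℝ) + 1)) * N := by
    rw [hNdef, ← mul_assoc, ← Real.rpow_add hV0]
    simp
  rw [hNN] at hM2
  have hmain := cutoff_max_le hR hT hlam hLam hB hc₀ hr0 hrR hRr hM0 hG0 hN0 hC₁ hβ0 hM2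
  rw [hK] at hmain
  have hfin : u X₀ ≤ (a + b) / δ ^ (2 * l + 2) *
      (N + (T * R⁻¹) ^ ((n : ℝ) / ((n : ℝ) + 1)) * G) := by
    have h1 : δ ^ (2 * l + 2) * u X₀ ≤ M := le_trans (by gcongr) hM1
    rw [div_mul_eq_mul_div, le_div_iff₀ (by positivity)]
    have h2 : 0 ≤ (T * R⁻¹) ^ ((n : ℝ) / ((n : ℝ) + 1)) * G := by positivity
    have h3 : 0 ≤ b * ((T * R⁻¹) ^ ((n : ℝ) / ((n : ℝ) + 1)) * G) := by positivity
    have h4 : 0 ≤ a * N := by positivity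
    calc u X₀ * δ ^ (2 * l + 2) = δ ^ (2 * l + 2) * u X₀ := mul_comm _ _
      _ ≤ M := h1
      _ ≤ a * ((T * R⁻¹) ^ ((n : ℝ) / ((n : ℝ) + 1)) * G) + b * N := by
        rw [ha, mul_assoc]; exact hmain
      _ ≤ _ := by linarith
  calc ENNReal.ofReal (u X₀) ≤ ENNReal.ofReal ((a + b) / δ ^ (2 * l + 2) *
      (N + (T * R⁻¹) ^ ((n : ℝ) / ((n : ℝ) + 1)) * G)) := ENNReal.ofReal_le_ofReal hfin
    _ = _ := by
      rw [ENNReal.ofReal_mul (by positivity), ENNReal.ofReal_add hN0 (by positivity), hNdef,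
        ENNReal.ofReal_mul (by positivity), ENNReal.ofReal_mul (by positivity), hVp,
        ENNReal.ofReal_toReal hNt, ENNReal.ofReal_toReal hGt]

/-! ### Mollification -/

/-- The mollification of `h` by the normalized bump function `φ`. -/
noncomputable def mollify {n : ℕ} (φ : ContDiffBump (0 : SpaceTime n)) (h : SpaceTime n → ℝ) :
    SpaceTime n → ℝ :=
  convolution (φ.normed volume) h (ContinuousLinearMap.lsmul ℝ ℝ) volume

section Mollify

variable {n : ℕ} {φ : ContDiffBump (0 : SpaceTime n)} {h k : SpaceTime n → ℝ}

theorem contDiff_mollify (hh : LocallyIntegrable h) : ContDiff ℝ 2 (mollify φ h) :=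
  (φ.hasCompactSupport_normed.contDiff_convolution_left (n := 2) _ φ.contDiff_normed hh)

theorem mollify_add (hh : LocallyIntegrable h) (hk : LocallyIntegrable k) :
    mollify φ (h + k) = mollify φ h + mollify φ k :=
  (φ.hasCompactSupport_normed.convolutionExists_left _ φ.continuous_normed hh).distrib_add
    (φ.hasCompactSupport_normed.convolutionExists_left _ φ.continuous_normed hk)

theorem mollify_eq_integral (X : SpaceTime n) :
    mollify φ h X = ∫ Y, φ.normed volume (X - Y) * h Y := by
  rw [mollify, convolution_eq_swap]
  simp

theorem fderiv_mollify_apply (hh : LocallyIntegrable h) (X e : SpaceTime n) :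
    fderiv ℝ (mollify φ h) X e = ∫ Y, fderiv ℝ (φ.normed volume) (X - Y) e * h Y := by
  have hφ : ContDiff ℝ 1 (φ.normed (volume : Measure (SpaceTime n))) := φ.contDiff_normed
  have h1 := (φ.hasCompactSupport_normed.hasFDerivAt_convolution_left
    (ContinuousLinearMap.lsmul ℝ ℝ) hφ hh X).fderiv
  have hex := (φ.hasCompactSupport_normed (μ := volume)).fderiv ℝ
  have h2 := (hex.convolutionExists_left ((ContinuousLinearMap.lsmul ℝ ℝ).precompL (SpaceTime n))
    (hφ.continuous_fderiv (by norm_num)) hh) X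
  change fderiv ℝ (convolution _ _ _ _) X e = _
  rw [h1, convolution_def, ContinuousLinearMap.integral_apply h2]
  rw [← integral_sub_left_eq_self _ volume X]
  simp [ContinuousLinearMap.precompL_apply]

/-- Near a point whose `φ`-neighbourhood lies in `K`, mollification of the truncations to `K`
commutes with weak differentiation. -/
theorem IsWeakDeriv.fderiv_mollify {Ω K : Set (SpaceTime n)} {e : SpaceTime n}
    {u g : SpaceTime n → ℝ} (hug : IsWeakDeriv Ω e u g) (hΩ : MeasurableSet Ω) (hK : IsCompact K)
    (hKΩ : K ⊆ Ω) {X : SpaceTime n} (hX : Metric.closedBall X φ.rOut ⊆ K) :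
    fderiv ℝ (mollify φ (K.indicator u)) X e = mollify φ (K.indicator g) X := by
  have huK : IntegrableOn u K := hug.locallyIntegrableOn.integrableOn_compact_subset hKΩ hK
  have hlu : LocallyIntegrable (K.indicator u) :=
    ((integrable_indicator_iff hK.measurableSet).2 huK).locallyIntegrable
  have hφ : ContDiff ℝ ∞ (φ.normed (volume : Measure (SpaceTime n))) := φ.contDiff_normed
  set ψ : SpaceTime n → ℝ := fun Y => φ.normed volume (X - Y) with hψ
  have hfψ : ∀ Y, fderiv ℝ ψ Y e = -fderiv ℝ (φ.normed volume) (X - Y) e := by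
    intro Y
    have h1 := (hφ.differentiable (by simp) (X - Y)).hasFDerivAt.comp Y
      ((hasFDerivAt_id Y).const_sub X)
    have h2 := h1.fderiv
    change fderiv ℝ ψ Y = _ at h2
    rw [h2]
    simp
  have hsupp : tsupport ψ ⊆ Metric.closedBall X φ.rOut := by
    refine closure_minimal ?_ Metric.isClosed_closedBall
    intro Y hY
    have h1 : X - Y ∈ Function.support (φ.normed (volume : Measure (SpaceTime n))) := hY
    rw [φ.support_normed_eq] at h1
    rw [Metric.mem_closedBall, dist_comm, dist_eq_norm]
    simpa using (mem_ball_zero_iff.1 h1).le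
  have htest : IsTestFunction Ω ψ :=
    ⟨hφ.comp (contDiff_const.sub contDiff_id),
      HasCompactSupport.of_support_subset_isCompact (isCompact_closedBall X φ.rOut)
        (subset_closure.trans hsupp), hsupp.trans (hX.trans hKΩ)⟩
  have hψ0 : ∀ Y, Y ∉ K → ψ Y = 0 := fun Y hY =>
    image_eq_zero_of_notMem_tsupport fun h => hY (hX (hsupp h))
  have hfψ0 : ∀ Y, Y ∉ K → fderiv ℝ ψ Y e = 0 := fun Y hY => by
    rw [fderiv_of_notMem_tsupport ℝ (fun h => hY (hX (hsupp h)))]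
    simp
  have hint := hug.integral_eq ψ htest
  rw [← integral_indicator hΩ, ← integral_indicator hΩ] at hint
  have e1 : Ω.indicator (fun Y => u Y * fderiv ℝ ψ Y e) =
      fun Y => -(fderiv ℝ (φ.normed volume) (X - Y) e * K.indicator u Y) := by
    funext Y
    by_cases hY : Y ∈ K
    · rw [Set.indicator_of_mem (hKΩ hY), Set.indicator_of_mem hY, hfψ]
      ring
    · rw [Set.indicator_of_notMem hY]
      by_cases hY' : Y ∈ Ω
      · rw [Set.indicator_of_mem hY', hfψ0 Y hY]; simp
      · rw [Set.indicator_of_notMem hY']; simp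
  have e2 : Ω.indicator (fun Y => g Y * ψ Y) =
      fun Y => φ.normed volume (X - Y) * K.indicator g Y := by
    funext Y
    by_cases hY : Y ∈ K
    · rw [Set.indicator_of_mem (hKΩ hY), Set.indicator_of_mem hY, mul_comm]
    · rw [Set.indicator_of_notMem hY]
      by_cases hY' : Y ∈ Ω
      · rw [Set.indicator_of_mem hY', hψ0 Y hY]; simp
      · rw [Set.indicator_of_notMem hY']; simp
  rw [e1, e2, integral_neg, neg_inj] at hint
  rw [fderiv_mollify_apply hlu, hint, mollify_eq_integral]

theorem enorm_mollify_rpow_le {q : ℝ} (hq : 1 ≤ q) (hh : Measurable h) (X : SpaceTime n) :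
    ‖mollify φ h X‖ₑ ^ q ≤ ∫⁻ Y, ENNReal.ofReal (φ.normed volume Y) * ‖h (X - Y)‖ₑ ^ q := by
  have hφm : Measurable fun Y => ENNReal.ofReal (φ.normed volume Y) :=
    φ.continuous_normed.measurable.ennreal_ofReal
  set ν := (volume : Measure (SpaceTime n)).withDensity
    fun Y => ENNReal.ofReal (φ.normed volume Y) with hν
  have hprob : IsProbabilityMeasure ν := by
    refine ⟨?_⟩
    rw [hν, withDensity_apply _ MeasurableSet.univ, Measure.restrict_univ,
      ← ofReal_integral_eq_lintegral_ofReal φ.integrable_normed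
        (Filter.Eventually.of_forall φ.nonneg_normed), φ.integral_normed, ENNReal.ofReal_one]
  have hm : Measurable fun Y => h (X - Y) := hh.comp (measurable_const.sub measurable_id)
  have h1 : ‖mollify φ h X‖ₑ ≤ eLpNorm (fun Y => h (X - Y)) 1 ν := by
    rw [eLpNorm_one_eq_lintegral_enorm, hν, lintegral_withDensity_eq_lintegral_mul _ hφm hm.enorm,
      mollify, convolution_def]
    refine (enorm_integral_le_lintegral_enorm _).trans (lintegral_mono fun Y => ?_)
    simp [enorm_mul, Real.enorm_eq_ofReal (φ.nonneg_normed Y)]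
  have h2 : eLpNorm (fun Y => h (X - Y)) 1 ν ≤ eLpNorm (fun Y => h (X - Y)) (ENNReal.ofReal q) ν :=
    eLpNorm_le_eLpNorm_of_exponent_le (by simpa using hq) hm.aestronglyMeasurable
  have hq0 : 0 < q := by linarith
  calc ‖mollify φ h X‖ₑ ^ q ≤ eLpNorm (fun Y => h (X - Y)) (ENNReal.ofReal q) ν ^ q := by
        gcongr; exact h1.trans h2
    _ = ∫⁻ Y, ‖h (X - Y)‖ₑ ^ q ∂ν := by
        rw [eLpNorm_eq_lintegral_rpow_enorm_toReal (by simpa using hq0) ENNReal.ofReal_ne_top,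
          ENNReal.toReal_ofReal hq0.le, ← ENNReal.rpow_mul, one_div_mul_cancel hq0.ne',
          ENNReal.rpow_one]
    _ = _ := by
        rw [hν, lintegral_withDensity_eq_lintegral_mul _ hφm (hm.enorm.pow_const q)]
        rfl

/-- Mollification is a contraction on `L^q`. -/
theorem eLpNorm_mollify_le {q : ℝ} (hq : 1 ≤ q) (hh : AEStronglyMeasurable h) :
    eLpNorm (mollify φ h) (ENNReal.ofReal q) volume ≤ eLpNorm h (ENNReal.ofReal q) volume := by
  wlog hm : Measurable h generalizing h
  · have h1 := this (h := hh.mk h) hh.stronglyMeasurable_mk.aestronglyMeasurable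
      hh.stronglyMeasurable_mk.measurable
    rw [eLpNorm_congr_ae hh.ae_eq_mk]
    have h2 : mollify φ h = mollify φ (hh.mk h) :=
      convolution_congr _ Filter.EventuallyEq.rfl hh.ae_eq_mk
    rwa [h2]
  have hq0 : 0 < q := by linarith
  have hφm : Measurable fun Y => ENNReal.ofReal (φ.normed (volume : Measure (SpaceTime n)) Y) :=
    φ.continuous_normed.measurable.ennreal_ofReal
  rw [eLpNorm_eq_lintegral_rpow_enorm_toReal (by simpa using hq0) ENNReal.ofReal_ne_top,
    eLpNorm_eq_lintegral_rpow_enorm_toReal (by simpa using hq0) ENNReal.ofReal_ne_top,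
    ENNReal.toReal_ofReal hq0.le]
  refine ENNReal.rpow_le_rpow ?_ (by positivity)
  have hone : ∫⁻ Y, ENNReal.ofReal (φ.normed (volume : Measure (SpaceTime n)) Y) = 1 := by
    rw [← ofReal_integral_eq_lintegral_ofReal φ.integrable_normed
        (Filter.Eventually.of_forall φ.nonneg_normed), φ.integral_normed, ENNReal.ofReal_one]
  calc ∫⁻ X, ‖mollify φ h X‖ₑ ^ q
      ≤ ∫⁻ X, ∫⁻ Y, ENNReal.ofReal (φ.normed volume Y) * ‖h (X - Y)‖ₑ ^ q :=
        lintegral_mono fun X => enorm_mollify_rpow_le hq hm X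
    _ = ∫⁻ Y, ∫⁻ X, ENNReal.ofReal (φ.normed volume Y) * ‖h (X - Y)‖ₑ ^ q := by
        refine lintegral_lintegral_swap (Measurable.aemeasurable ?_)
        exact (hφm.comp measurable_snd).mul
          ((hm.comp (measurable_fst.sub measurable_snd)).enorm.pow_const q)
    _ = ∫⁻ Y, ENNReal.ofReal (φ.normed volume Y) * ∫⁻ X, ‖h X‖ₑ ^ q := by
        refine lintegral_congr fun Y => ?_
        rw [lintegral_const_mul' _ _ ENNReal.ofReal_ne_top,
          lintegral_sub_right_eq_self (fun X => ‖h X‖ₑ ^ q) Y]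
    _ = ∫⁻ X, ‖h X‖ₑ ^ q := by
        rw [lintegral_mul_const _ hφm, hone, one_mul]

theorem tendsto_eLpNorm_mollify_sub {φ : ℕ → ContDiffBump (0 : SpaceTime n)}
    (hφ : Filter.Tendsto (fun j => (φ j).rOut) Filter.atTop (nhds 0)) {q : ℝ} (hq : 1 ≤ q)
    (hh : MemLp h (ENNReal.ofReal q)) {Q : Set (SpaceTime n)} (hQ : volume Q ≠ ⊤) :
    Filter.Tendsto (fun j => eLpNorm (mollify (φ j) h - h) (ENNReal.ofReal q) (volume.restrict Q))
      Filter.atTop (nhds 0) := by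
  have hq1 : (1 : ℝ≥0∞) ≤ ENNReal.ofReal q := by simpa using hq
  rw [ENNReal.tendsto_nhds_zero]
  intro ε hε
  have hε3 : ε / 3 ≠ 0 := (ENNReal.div_pos hε.ne' (by simp)).ne'
  obtain ⟨k, hkc, hk, hkcont, hkm⟩ := hh.exists_hasCompactSupport_eLpNorm_sub_le
    ENNReal.ofReal_ne_top hε3
  -- a uniform bound whose norm over `Q` is at most `ε / 3`
  obtain ⟨η, hη0, hη⟩ : ∃ η : ℝ, 0 < η ∧
      volume Q ^ (ENNReal.ofReal q).toReal⁻¹ * ENNReal.ofReal η ≤ ε / 3 := by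
    have hV : volume Q ^ (ENNReal.ofReal q).toReal⁻¹ ≠ ⊤ :=
      ENNReal.rpow_ne_top_of_nonneg (by positivity) hQ
    have ht : Filter.Tendsto (fun η : ℝ =>
        volume Q ^ (ENNReal.ofReal q).toReal⁻¹ * ENNReal.ofReal η) (nhdsWithin 0 (Set.Ioi 0))
        (nhds 0) := by
      have h1 := ENNReal.Tendsto.const_mul (a := volume Q ^ (ENNReal.ofReal q).toReal⁻¹)
        ((ENNReal.continuous_ofReal.tendsto 0).mono_left
          (nhdsWithin_le_nhds (s := Set.Ioi (0 : ℝ)))) (Or.inr hV)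
      simpa using h1
    obtain ⟨η, h1, h2⟩ := ((ENNReal.tendsto_nhds_zero.1 ht (ε / 3) (pos_iff_ne_zero.2 hε3)).and
      self_mem_nhdsWithin).exists
    exact ⟨η, h2, h1⟩
  obtain ⟨d, hd0, hd⟩ := Metric.uniformContinuous_iff.1
    (hkc.uniformContinuous_of_continuous hkcont) η hη0
  filter_upwards [hφ.eventually (gt_mem_nhds hd0)] with j hj
  have hlh : LocallyIntegrable h := hh.locallyIntegrable hq1
  have hlk : LocallyIntegrable k := hkcont.locallyIntegrable
  have hdec : mollify (φ j) h - h = mollify (φ j) (h - k) + ((mollify (φ j) k - k) + (k - h)) := by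
    have h1 : mollify (φ j) h = mollify (φ j) (h - k) + mollify (φ j) k := by
      rw [← mollify_add (hlh.sub hlk) hlk, sub_add_cancel]
    rw [h1]
    abel
  have m1 : Continuous (mollify (φ j) (h - k)) := (contDiff_mollify (hlh.sub hlk)).continuous
  have m2 : Continuous (mollify (φ j) k) := (contDiff_mollify hlk).continuous
  have m3 : AEStronglyMeasurable (k - h) (volume.restrict Q) :=
    (hkcont.aestronglyMeasurable.sub hh.1).restrict
  have m4 : AEStronglyMeasurable (mollify (φ j) k - k) (volume.restrict Q) :=
    (m2.sub hkcont).aestronglyMeasurable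
  have b1 : eLpNorm (mollify (φ j) (h - k)) (ENNReal.ofReal q) (volume.restrict Q) ≤ ε / 3 :=
    (eLpNorm_mono_measure _ Measure.restrict_le_self).trans
      ((eLpNorm_mollify_le hq (hh.1.sub hkcont.aestronglyMeasurable)).trans hk)
  have b3 : eLpNorm (k - h) (ENNReal.ofReal q) (volume.restrict Q) ≤ ε / 3 := by
    rw [eLpNorm_sub_comm]
    exact (eLpNorm_mono_measure _ Measure.restrict_le_self).trans hk
  have b2 : eLpNorm (mollify (φ j) k - k) (ENNReal.ofReal q) (volume.restrict Q) ≤ ε / 3 := by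
    refine (eLpNorm_le_of_ae_bound (C := η) (Filter.Eventually.of_forall fun X => ?_)).trans ?_
    · rw [Pi.sub_apply, ← dist_eq_norm]
      refine ContDiffBump.dist_normed_convolution_le hkcont.aestronglyMeasurable fun Y hY => ?_
      exact (hd ((Metric.mem_ball.1 hY).trans hj)).le
    · simpa using hη
  rw [hdec]
  calc _ ≤ ε / 3 + (ε / 3 + ε / 3) :=
        (eLpNorm_add_le m1.aestronglyMeasurable (m4.add m3) hq1).trans
          (add_le_add b1 ((eLpNorm_add_le m4 m3 hq1).trans (add_le_add b2 b3)))
    _ = ε := by rw [← add_assoc]; exact ENNReal.add_thirds ε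

theorem tendsto_mollify_of_continuousAt {φ : ℕ → ContDiffBump (0 : SpaceTime n)}
    (hφ : Filter.Tendsto (fun j => (φ j).rOut) Filter.atTop (nhds 0))
    (hh : AEStronglyMeasurable h) {X : SpaceTime n} (hX : ContinuousAt h X) :
    Filter.Tendsto (fun j => mollify (φ j) h X) Filter.atTop (nhds (h X)) :=
  ContDiffBump.convolution_tendsto_right hφ (Filter.Eventually.of_forall fun _ => hh)
    (hX.tendsto.comp Filter.tendsto_snd) tendsto_const_nhds

theorem abs_mollify_le {S : ℝ} (hh : AEStronglyMeasurable h) (hS : ∀ Y, |h Y| ≤ S)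
    (X : SpaceTime n) : |mollify φ h X| ≤ 3 * S := by
  have h1 := ContDiffBump.dist_normed_convolution_le (φ := φ) (x₀ := X) (ε := 2 * S) hh
    fun Y _ => by
      rw [Real.dist_eq]
      exact (abs_sub _ _).trans (by linarith [hS X, hS Y])
  change dist (mollify φ h X) (h X) ≤ 2 * S at h1
  rw [Real.dist_eq] at h1
  have h2 := abs_sub_abs_le_abs_sub (mollify φ h X) (h X)
  linarith [hS X]

end Mollify

/-! ### Smooth approximation in parabolic Sobolev spaces -/

/-- A sequence of measurable functions that converges to zero in `L^q`. -/
def TendstoZeroInLp {n : ℕ} (q : ℝ≥0∞) (μ : Measure (SpaceTime n))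
    (F : ℕ → SpaceTime n → ℝ) : Prop :=
  (∀ j, AEStronglyMeasurable (F j) μ) ∧
    Filter.Tendsto (fun j => eLpNorm (F j) q μ) Filter.atTop (nhds 0)

section TendstoZeroInLp

variable {n : ℕ} {q : ℝ≥0∞} {μ : Measure (SpaceTime n)} {F G : ℕ → SpaceTime n → ℝ}

theorem TendstoZeroInLp.add (hq : 1 ≤ q) (hF : TendstoZeroInLp q μ F)
    (hG : TendstoZeroInLp q μ G) : TendstoZeroInLp q μ fun j X => F j X + G j X := by
  refine ⟨fun j => (hF.1 j).add (hG.1 j), ?_⟩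
  refine tendsto_of_tendsto_of_tendsto_of_le_of_le tendsto_const_nhds
    (by simpa using hF.2.add hG.2) (fun _ => zero_le) fun j => ?_
  exact eLpNorm_add_le (hF.1 j) (hG.1 j) hq

theorem TendstoZeroInLp.neg (hF : TendstoZeroInLp q μ F) :
    TendstoZeroInLp q μ fun j X => -F j X := by
  refine ⟨fun j => (hF.1 j).neg, ?_⟩
  have : (fun j => eLpNorm (fun X => -F j X) q μ) = fun j => eLpNorm (F j) q μ :=
    funext fun j => eLpNorm_neg (F j) q μ
  rw [this]
  exact hF.2

theorem TendstoZeroInLp.mul_left {a : SpaceTime n → ℝ} {C : ℝ} (ha : AEMeasurable a μ)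
    (haC : ∀ᵐ X ∂μ, |a X| ≤ C) (hF : TendstoZeroInLp q μ F) :
    TendstoZeroInLp q μ fun j X => a X * F j X := by
  refine ⟨fun j => ha.aestronglyMeasurable.mul (hF.1 j), ?_⟩
  have h1 := ENNReal.Tendsto.const_mul hF.2 (Or.inr (ENNReal.ofReal_ne_top (r := C)))
  rw [mul_zero] at h1
  refine tendsto_of_tendsto_of_tendsto_of_le_of_le tendsto_const_nhds h1
    (fun _ => zero_le) fun j => ?_
  refine eLpNorm_le_mul_eLpNorm_of_ae_le_mul ?_ q
  filter_upwards [haC] with X hX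
  rw [norm_mul]
  gcongr
  exact hX

theorem TendstoZeroInLp.sum {ι : Type*} (hq : 1 ≤ q) (s : Finset ι)
    {F : ι → ℕ → SpaceTime n → ℝ} (hF : ∀ i, TendstoZeroInLp q μ (F i)) :
    TendstoZeroInLp q μ fun j X => ∑ i ∈ s, F i j X := by
  classical
  induction s using Finset.induction_on with
  | empty =>
    refine ⟨fun j => ?_, ?_⟩
    · simpa using aestronglyMeasurable_const
    · simp
  | insert i s hi ih =>
    simp only [Finset.sum_insert hi]
    exact (hF i).add hq ih

end TendstoZeroInLp

/-- Approximation of a `W^{2,1}_{q,loc}` function by smooth ones near a compact subset `Q'` of `Ω`: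
uniformly bounded, pointwise convergent, and with `Lw_j → Lu` in `L^q(Q)` for `Q ⊆ Q'`, for any
operator `L` with bounded measurable coefficients. -/
theorem IsW21Loc.exists_smooth_approximation {n : ℕ} {q : ℝ} (hq : 1 ≤ q)
    {Ω Q Q' : Set (SpaceTime n)} (hΩ : IsOpen Ω) (hQ' : IsCompact Q') (hQ'Ω : Q' ⊆ Ω) (hQQ' : Q ⊆ Q')
    (hQm : MeasurableSet Q) {u ut : SpaceTime n → ℝ} {Du : Fin n → SpaceTime n → ℝ}
    {D2u : Fin n → Fin n → SpaceTime n → ℝ} (hu : IsW21Loc (ENNReal.ofReal q) Ω u ut Du D2u)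
    (huc : ContinuousOn u Ω) {L : ParabolicCoeffs n} {lam Lam B c₀ : ℝ} (hlam : 0 ≤ lam)
    (hL : L.IsBounded Ω lam Lam B c₀) :
    ∃ w : ℕ → SpaceTime n → ℝ, (∀ j, ContDiff ℝ 2 (w j)) ∧
      (∀ X ∈ Q', Filter.Tendsto (fun j => w j X) Filter.atTop (nhds (u X))) ∧
      (∃ S : ℝ, ∀ j X, |w j X| ≤ S) ∧
      (∀ j, AEStronglyMeasurable (fun X => L.apply (w j) X - L.op u ut Du D2u X)
        (volume.restrict Q)) ∧
      Filter.Tendsto (fun j => eLpNorm (fun X => L.apply (w j) X - L.op u ut Du D2u X)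
        (ENNReal.ofReal q) (volume.restrict Q)) Filter.atTop (nhds 0) := by
  have hq1 : (1 : ℝ≥0∞) ≤ ENNReal.ofReal q := by simpa using hq
  obtain ⟨K, hK, hQK, hKΩ⟩ := exists_compact_between hQ' hΩ hQ'Ω
  obtain ⟨δ, hδ0, hδ⟩ := hQ'.exists_thickening_subset_open isOpen_interior hQK
  have hQ'K : Q' ⊆ K := hQK.trans interior_subset
  have hQ'fin : volume Q ≠ ⊤ := ((measure_mono hQQ').trans_lt hQ'.measure_lt_top).ne
  let φ : ℕ → ContDiffBump (0 : SpaceTime n) := fun j =>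
    ⟨1 / (2 * ((j : ℝ) + 1)), 1 / ((j : ℝ) + 1), by positivity, by
      gcongr
      have : (0 : ℝ) ≤ j := Nat.cast_nonneg j
      linarith⟩
  have hφ : Filter.Tendsto (fun j => (φ j).rOut) Filter.atTop (nhds 0) :=
    tendsto_one_div_add_atTop_nhds_zero_nat
  have hmem : ∀ g : SpaceTime n → ℝ, MemLpLoc (ENNReal.ofReal q) Ω g →
      MemLp (K.indicator g) (ENNReal.ofReal q) := fun g hg =>
    (memLp_indicator_iff_restrict hK.measurableSet).2 (hg K hKΩ hK)
  have hvan : ∀ g : SpaceTime n → ℝ, MemLpLoc (ENNReal.ofReal q) Ω g →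
      TendstoZeroInLp (ENNReal.ofReal q) (volume.restrict Q)
        fun j X => mollify (φ j) (K.indicator g) X - K.indicator g X := fun g hg => by
    refine ⟨fun j => ?_, tendsto_eLpNorm_mollify_sub hφ hq (hmem g hg) hQ'fin⟩
    exact (contDiff_mollify ((hmem g hg).locallyIntegrable hq1)).continuous.aestronglyMeasurable.sub
      (hmem g hg).1.restrict
  have hae : ∀ p : SpaceTime n → Prop, (∀ X ∈ Ω, p X) → ∀ᵐ X ∂volume.restrict Q, p X :=
    fun p hp => (ae_restrict_iff' hQm).2
      (Filter.Eventually.of_forall fun X hX => hp X (hQ'Ω (hQQ' hX)))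
  have hle : volume.restrict Q ≤ volume.restrict Ω :=
    Measure.restrict_mono (hQQ'.trans hQ'Ω) le_rfl
  obtain ⟨Mc, hMc⟩ := hL.c_bounded
  -- the difference `Lw_j - Lu` in terms of the mollification errors
  have hdiff : TendstoZeroInLp (ENNReal.ofReal q) (volume.restrict Q) fun j X =>
      -(mollify (φ j) (K.indicator ut) X - K.indicator ut X) +
        ∑ i, ∑ k, L.a X i k * (mollify (φ j) (K.indicator (D2u i k)) X - K.indicator (D2u i k) X) +
        ∑ i, L.b X i * (mollify (φ j) (K.indicator (Du i)) X - K.indicator (Du i) X) +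
        L.c X * (mollify (φ j) (K.indicator u) X - K.indicator u X) := by
    refine (((hvan _ hu.memLpLoc_time).neg.add hq1 ?_).add hq1 ?_).add hq1 ?_
    · exact TendstoZeroInLp.sum hq1 _ fun i => TendstoZeroInLp.sum hq1 _ fun k =>
        (hvan _ (hu.memLpLoc_space_space i k)).mul_left ((hL.aemeasurable_a i k).mono_measure hle)
          (hae _ fun X hX =>
            (hL.posSemidef hlam hX).abs_apply_le (hL.posSemidef_smul_one_sub hX) i k)
    · exact TendstoZeroInLp.sum hq1 _ fun i =>
        (hvan _ (hu.memLpLoc_space i)).mul_left ((hL.aemeasurable_b i).mono_measure hle)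
          (hae _ fun X hX => (PiLp.norm_apply_le (L.b X) i).trans (hL.norm_b_le X hX))
    · exact (hvan _ hu.memLpLoc).mul_left (hL.aemeasurable_c.mono_measure hle) (hae _ hMc)
  have hnear : ∀ j, (φ j).rOut < δ / 2 → ∀ X ∈ Metric.thickening (δ / 2) Q',
      Metric.closedBall X (φ j).rOut ⊆ K := by
    intro j hj X hX Y hY
    refine interior_subset (hδ ?_)
    rw [Metric.mem_thickening_iff] at hX ⊢
    obtain ⟨Z, hZ, hXZ⟩ := hX
    refine ⟨Z, hZ, (dist_triangle Y X Z).trans_lt ?_⟩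
    linarith [Metric.mem_closedBall.1 hY]
  have hsub : Q' ⊆ Metric.thickening (δ / 2) Q' := Metric.self_subset_thickening (by positivity) _
  have happly : ∀ j, (φ j).rOut < δ / 2 → ∀ X ∈ Q,
      L.apply (mollify (φ j) (K.indicator u)) X - L.op u ut Du D2u X =
      -(mollify (φ j) (K.indicator ut) X - K.indicator ut X) +
        ∑ i, ∑ k, L.a X i k * (mollify (φ j) (K.indicator (D2u i k)) X - K.indicator (D2u i k) X) +
        ∑ i, L.b X i * (mollify (φ j) (K.indicator (Du i)) X - K.indicator (Du i) X) +
        L.c X * (mollify (φ j) (K.indicator u) X - K.indicator u X) := by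
    intro j hj X hX
    have hXK : X ∈ K := hQ'K (hQQ' hX)
    have hXt := hsub (hQQ' hX)
    have hΩm := hΩ.measurableSet
    have h1 : timeDeriv (mollify (φ j) (K.indicator u)) X = mollify (φ j) (K.indicator ut) X :=
      hu.isWeakDeriv_time.fderiv_mollify hΩm hK hKΩ (hnear j hj X hXt)
    have h2 : ∀ Y ∈ Metric.thickening (δ / 2) Q', ∀ i,
        fderiv ℝ (mollify (φ j) (K.indicator u)) Y (spaceDir i) =
          mollify (φ j) (K.indicator (Du i)) Y := fun Y hY i =>
      (hu.isWeakDeriv_space i).fderiv_mollify hΩm hK hKΩ (hnear j hj Y hY)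
    have h3 : ∀ i k, spaceHess (mollify (φ j) (K.indicator u)) X i k =
        mollify (φ j) (K.indicator (D2u i k)) X := by
      intro i k
      have h4 : (fun Y => fderiv ℝ (mollify (φ j) (K.indicator u)) Y (spaceDir i)) =ᶠ[nhds X]
          mollify (φ j) (K.indicator (Du i)) :=
        Filter.eventuallyEq_of_mem (Metric.isOpen_thickening.mem_nhds hXt) fun Y hY => h2 Y hY i
      rw [spaceHess, h4.fderiv_eq]
      exact (hu.isWeakDeriv_space_space i k).fderiv_mollify hΩm hK hKΩ (hnear j hj X hXt)
    simp only [ParabolicCoeffs.apply, ParabolicCoeffs.op, h1, h3, spaceGrad, h2 X hXt,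
      Set.indicator_of_mem hXK, mul_sub, Finset.sum_sub_distrib]
    ring
  obtain ⟨N, hN⟩ := Filter.eventually_atTop.1
    (hφ.eventually (gt_mem_nhds (by positivity : 0 < δ / 2)))
  have haeeq : ∀ j, (fun X => L.apply (mollify (φ (j + N)) (K.indicator u)) X -
      L.op u ut Du D2u X) =ᵐ[volume.restrict Q] fun X =>
      -(mollify (φ (j + N)) (K.indicator ut) X - K.indicator ut X) +
        ∑ i, ∑ k, L.a X i k *
          (mollify (φ (j + N)) (K.indicator (D2u i k)) X - K.indicator (D2u i k) X) +
        ∑ i, L.b X i * (mollify (φ (j + N)) (K.indicator (Du i)) X - K.indicator (Du i) X) +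
        L.c X * (mollify (φ (j + N)) (K.indicator u) X - K.indicator u X) := fun j =>
    (ae_restrict_iff' hQm).2 (Filter.Eventually.of_forall fun X hX =>
      happly (j + N) (hN _ (Nat.le_add_left N j)) X hX)
  have hshift : Filter.Tendsto (fun j : ℕ => j + N) Filter.atTop Filter.atTop :=
    Filter.tendsto_add_atTop_nat N
  have huK := hmem u hu.memLpLoc
  obtain ⟨S, hS⟩ := hK.exists_bound_of_continuousOn (huc.mono hKΩ)
  refine ⟨fun j => mollify (φ (j + N)) (K.indicator u),
    fun j => contDiff_mollify (huK.locallyIntegrable hq1), fun X hX => ?_, ⟨3 * max S 0, ?_⟩,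
    fun j => (hdiff.1 (j + N)).congr (haeeq j).symm, ?_⟩
  · have hXn : K ∈ nhds X := mem_interior_iff_mem_nhds.1 (hQK hX)
    have hcont : ContinuousAt (K.indicator u) X := by
      refine (huc.continuousAt (hΩ.mem_nhds (hQ'Ω hX))).congr ?_
      filter_upwards [hXn] with Y hY
      rw [Set.indicator_of_mem hY]
    have := (tendsto_mollify_of_continuousAt hφ huK.1 hcont).comp hshift
    rwa [Set.indicator_of_mem (hQ'K hX)] at this
  · intro j X
    refine abs_mollify_le huK.1 (fun Y => ?_) X
    by_cases hY : Y ∈ K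
    · rw [Set.indicator_of_mem hY]
      exact (hS Y hY).trans (le_max_left _ _)
    · rw [Set.indicator_of_notMem hY, abs_zero]
      exact le_max_right _ _
  · refine (hdiff.2.comp hshift).congr fun j => ?_
    exact (eLpNorm_congr_ae (haeeq j)).symm

/-! ### The limit passage -/

/-- Bounded pointwise convergence on a set of finite measure implies convergence of the `L^q`
(quasi-)norms of the positive parts, for every `q > 0`. -/
theorem tendsto_eLpNorm_max_zero {n : ℕ} {q : ℝ} (hq : 0 < q) {Q : Set (SpaceTime n)}
    (hQm : MeasurableSet Q) (hQ : volume Q ≠ ⊤) {w : ℕ → SpaceTime n → ℝ} {u : SpaceTime n → ℝ}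
    (hw : ∀ j, Continuous (w j)) {S : ℝ} (hS : ∀ j X, |w j X| ≤ S)
    (hlim : ∀ X ∈ Q, Filter.Tendsto (fun j => w j X) Filter.atTop (nhds (u X))) :
    Filter.Tendsto (fun j => eLpNorm (fun X => max (w j X) 0) (ENNReal.ofReal q)
      (volume.restrict Q)) Filter.atTop
      (nhds (eLpNorm (fun X => max (u X) 0) (ENNReal.ofReal q) (volume.restrict Q))) := by
  have hq' : ENNReal.ofReal q ≠ 0 := by simpa using hq
  simp only [eLpNorm_eq_lintegral_rpow_enorm_toReal hq' ENNReal.ofReal_ne_top,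
    ENNReal.toReal_ofReal hq.le]
  refine (ENNReal.continuous_rpow_const.tendsto _).comp ?_
  refine tendsto_lintegral_of_dominated_convergence (fun _ => ENNReal.ofReal S ^ q)
    (fun j => (((hw j).max continuous_const).measurable.enorm.pow_const q)) (fun j => ?_) ?_ ?_
  · refine Filter.Eventually.of_forall fun X => ?_
    refine ENNReal.rpow_le_rpow ?_ hq.le
    rw [Real.enorm_eq_ofReal (le_max_right _ _)]
    refine ENNReal.ofReal_le_ofReal (max_le ((le_abs_self _).trans (hS j X)) ?_)
    exact (abs_nonneg _).trans (hS j X)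
  · rw [lintegral_const, Measure.restrict_apply_univ]
    exact ENNReal.mul_ne_top (ENNReal.rpow_ne_top_of_nonneg hq.le ENNReal.ofReal_ne_top) hQ
  · refine (ae_restrict_iff' hQm).2 (Filter.Eventually.of_forall fun X hX => ?_)
    have h1 := (hlim X hX).max (tendsto_const_nhds (x := (0 : ℝ)))
    exact (ENNReal.continuous_rpow_const.tendsto _).comp ((continuous_enorm.tendsto _).comp h1)

theorem isOpen_parabolicCylinder (n : ℕ) (R T : ℝ) : IsOpen (parabolicCylinder n R T) :=
  Metric.isOpen_ball.prod isOpen_Ioo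

theorem mem_smul_parabolicCylinder {n : ℕ} {R T ρ : ℝ} (hρ : 0 < ρ) {X : SpaceTime n}
    (hX : X ∈ ρ • parabolicCylinder n R T) :
    ‖X.1‖ ≤ ρ * R ∧ -(ρ * T) ≤ X.2 ∧ X.2 < 0 := by
  obtain ⟨Y, ⟨hY1, hY2, hY3⟩, rfl⟩ := hX
  have h1 : ‖Y.1‖ < R := by simpa using hY1
  refine ⟨?_, ?_, ?_⟩
  · simp only [Prod.smul_fst, norm_smul, Real.norm_of_nonneg hρ.le]
    gcongr
  · simp only [Prod.smul_snd, smul_eq_mul]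
    nlinarith
  · simp only [Prod.smul_snd, smul_eq_mul]
    exact mul_neg_of_pos_of_neg hρ hY3

/-- Normalized `L^q` norms increase with the exponent, also for exponents below `1`. -/
theorem rpow_mul_eLpNorm_mono_exponent {n : ℕ} {q p : ℝ} (hq : 0 < q) (hqp : q ≤ p)
    {Ω : Set (SpaceTime n)} (hΩ0 : volume Ω ≠ 0) (hΩt : volume Ω ≠ ⊤) {g : SpaceTime n → ℝ}
    (hg : AEStronglyMeasurable g (volume.restrict Ω)) :
    volume Ω ^ (-(1 / q)) * eLpNorm g (ENNReal.ofReal q) (volume.restrict Ω) ≤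
      volume Ω ^ (-(1 / p)) * eLpNorm g (ENNReal.ofReal p) (volume.restrict Ω) := by
  have hp : 0 < p := hq.trans_le hqp
  have h1 := eLpNorm_le_eLpNorm_mul_rpow_measure_univ (ENNReal.ofReal_le_ofReal hqp) hg
  rw [Measure.restrict_apply_univ, ENNReal.toReal_ofReal hq.le, ENNReal.toReal_ofReal hp.le] at h1
  calc _ ≤ volume Ω ^ (-(1 / q)) * (eLpNorm g (ENNReal.ofReal p) (volume.restrict Ω) *
        volume Ω ^ (1 / q - 1 / p)) := by gcongr
    _ = volume Ω ^ (-(1 / q) + (1 / q - 1 / p)) *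
        eLpNorm g (ENNReal.ofReal p) (volume.restrict Ω) := by
      rw [ENNReal.rpow_add _ _ hΩ0 hΩt]; ring
    _ = _ := by congr 2; ring

theorem mainTheorem12 (n : ℕ) (hn : 1 ≤ n) (p ρ : ℝ) (hp : 0 < p) (hρ0 : 0 < ρ) (hρ1 : ρ < 1)
    (K : ℝ) :
    ∃ C : ℝ, 0 < C ∧
      ∀ (R T lam0 Lam0 B c0 : ℝ), 0 < R → 0 < T → 0 < lam0 → 0 ≤ c0 →
        parabolicScaleConst n R T lam0 Lam0 B c0 = K →
      ∀ (L : ParabolicCoeffs n), L.IsBounded (parabolicCylinder n R T) lam0 Lam0 B c0 →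
      ∀ (u ut : SpaceTime n → ℝ) (Du : Fin n → SpaceTime n → ℝ)
        (D2u : Fin n → Fin n → SpaceTime n → ℝ) (f : SpaceTime n → ℝ),
        IsW21Loc ((n : ℝ≥0∞) + 1) (parabolicCylinder n R T) u ut Du D2u →
        ContinuousOn u (closure (parabolicCylinder n R T)) →
        AEMeasurable f (volume.restrict (parabolicCylinder n R T)) →
        (∀ᵐ X ∂(volume.restrict (parabolicCylinder n R T)), f X ≤ L.op u ut Du D2u X) →
        (⨆ X ∈ ρ • parabolicCylinder n R T, (u X : EReal)) ≤
          ((ENNReal.ofReal C *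
            (volume (parabolicCylinder n R T) ^ (-(1 / p)) *
                eLpNorm (fun X => max (u X) 0) (ENNReal.ofReal p)
                  (volume.restrict (parabolicCylinder n R T)) +
              ENNReal.ofReal ((T * R⁻¹) ^ ((n : ℝ) / ((n : ℝ) + 1))) *
                eLpNorm f ((n : ℝ≥0∞) + 1)
                  (volume.restrict (parabolicCylinder n R T))) : ℝ≥0∞) : EReal) := by
  -- `k = l + 1` is chosen so large that `q = (n + 1) / k ≤ p`
  obtain ⟨l, hl⟩ := exists_nat_ge (((n : ℝ) + 1) / p)
  set q := ((n : ℝ) + 1) / ((l + 1 : ℕ) : ℝ) with hq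
  have hq0 : 0 < q := by positivity
  have hqp : q ≤ p := by
    rw [hq, div_le_iff₀ (by positivity)]
    rw [div_le_iff₀ hp] at hl
    push_cast
    nlinarith
  obtain ⟨C, hC0, hC⟩ := exists_interior_estimate_of_contDiff n hn l hρ0 hρ1 K
  refine ⟨C, hC0, ?_⟩
  intro R T lam0 Lam0 B c0 hR hT hlam0 hc0 hK L hL u ut Du D2u f hu huc hf hfL
  set Ω := parabolicCylinder n R T with hΩ
  have hΩo : IsOpen Ω := isOpen_parabolicCylinder n R T
  have hcΩ : ContinuousOn u Ω := huc.mono subset_closure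
  have hn1 : (n : ℝ≥0∞) + 1 = ENNReal.ofReal ((n : ℝ) + 1) := by
    rw [ENNReal.ofReal_add (by positivity) (by norm_num)]; simp
  have hV := volume_parabolicCylinder (n := n) (T := T) hR
  have hVt : volume Ω ≠ ⊤ := by
    rw [hΩ, hV]
    exact ENNReal.mul_ne_top ENNReal.ofReal_ne_top measure_ball_lt_top.ne
  have hV0 : volume Ω ≠ 0 := by
    rw [hΩ, hV]
    refine mul_ne_zero ?_ (Metric.measure_ball_pos _ _ one_pos).ne'
    rw [Ne, ENNReal.ofReal_eq_zero, not_le]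
    positivity
  refine iSup₂_le fun X₀ hX₀ => ?_
  obtain ⟨hx, ht1, ht2⟩ := mem_smul_parabolicCylinder hρ0 hX₀
  have hcoe : (u X₀ : EReal) ≤ ((ENNReal.ofReal (u X₀) : ℝ≥0∞) : EReal) := by
    rw [EReal.coe_ennreal_ofReal]
    exact_mod_cast le_max_left (u X₀) 0
  refine hcoe.trans (EReal.coe_ennreal_le_coe_ennreal_iff.2 ?_)
  -- a cylinder with compact closure in `Ω` whose closure contains `X₀`
  set r := (1 + ρ) / 2 * R with hr
  set τ := -((1 + ρ) / 2 * T) with hτ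
  set Q := Metric.ball (0 : EuclideanSpace ℝ (Fin n)) r ×ˢ Set.Ioc τ X₀.2 with hQ
  set Q' := Metric.closedBall (0 : EuclideanSpace ℝ (Fin n)) r ×ˢ Set.Icc τ X₀.2 with hQ'
  have hQm : MeasurableSet Q := measurableSet_ball.prod measurableSet_Ioc
  have hQ'c : IsCompact Q' := (isCompact_closedBall 0 r).prod isCompact_Icc
  have hQQ' : Q ⊆ Q' := Set.prod_mono Metric.ball_subset_closedBall Set.Ioc_subset_Icc_self
  have hrR : ρ * R < r ∧ r < R := by constructor <;> rw [hr] <;> nlinarith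
  have hτT : τ < -(ρ * T) ∧ -T < τ := by constructor <;> rw [hτ] <;> nlinarith
  have hQ'Ω : Q' ⊆ Ω := by
    rintro X ⟨h1, h2, h3⟩
    have h4 : ‖X.1‖ ≤ r := by simpa using h1
    exact ⟨by simpa using h4.trans_lt hrR.2, hτT.2.trans_le h2, h3.trans_lt ht2⟩
  have hX₀Q' : X₀ ∈ Q' :=
    ⟨by simpa using hx.trans hrR.1.le, hτT.1.le.trans ht1, le_rfl⟩
  have hQΩ := hQQ'.trans hQ'Ω
  have hQt : volume Q ≠ ⊤ := ne_top_of_le_ne_top hVt (measure_mono hQΩ)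
  have hle : volume.restrict Q ≤ volume.restrict Ω := Measure.restrict_mono hQΩ le_rfl
  have hn0 : (1 : ℝ) ≤ (n : ℝ) + 1 := by linarith [(Nat.cast_nonneg n : (0 : ℝ) ≤ n)]
  rw [hn1] at hu
  obtain ⟨w, hw, hwlim, ⟨S, hS⟩, hwm, hwL⟩ := hu.exists_smooth_approximation hn0 hΩo hQ'c hQ'Ω
    hQQ' hQm hcΩ hlam0.le hL
  set s := ENNReal.ofReal ((T * R⁻¹) ^ ((n : ℝ) / ((n : ℝ) + 1))) with hs
  set Nq := eLpNorm (fun X => max (u X) 0) (ENNReal.ofReal q) (volume.restrict Q) with hNq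
  have hqinv : ((l + 1 : ℕ) : ℝ) / ((n : ℝ) + 1) = 1 / q := by rw [hq, one_div_div]
  -- the estimate for the approximations, with `Lw_j ≥ f - |Lw_j - Lu|` inserted
  have hj : ∀ j, ENNReal.ofReal (w j X₀) ≤ ENNReal.ofReal C * (volume Ω ^ (-(1 / q)) *
      eLpNorm (fun X => max (w j X) 0) (ENNReal.ofReal q) (volume.restrict Q) +
      s * (eLpNorm f ((n : ℝ≥0∞) + 1) (volume.restrict Ω) +
        eLpNorm (fun X => L.apply (w j) X - L.op u ut Du D2u X) (ENNReal.ofReal ((n : ℝ) + 1))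
          (volume.restrict Q))) := by
    intro j
    have h1 := hC R T lam0 Lam0 B c0 hR hT hlam0 hc0 hK L hL (w j) (hw j) X₀ hx ht1 ht2
    rw [hqinv] at h1
    refine h1.trans ?_
    gcongr
    have h2 : ∀ᵐ X ∂volume.restrict Q, ‖max (-L.apply (w j) X) 0‖ ≤
        ‖(|f X| + |L.apply (w j) X - L.op u ut Du D2u X|)‖ := by
      filter_upwards [ae_mono hle hfL] with X hX
      rw [Real.norm_of_nonneg (le_max_right _ _), Real.norm_of_nonneg (by positivity)]
      refine max_le ?_ (by positivity)
      have h3 := neg_abs_le (f X)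
      have h4 := neg_abs_le (L.apply (w j) X - L.op u ut Du D2u X)
      linarith
    refine (eLpNorm_mono_ae h2).trans ?_
    have hfQ : AEStronglyMeasurable f (volume.restrict Q) :=
      (hf.mono_measure hle).aestronglyMeasurable
    refine (eLpNorm_add_le hfQ.norm (hwm j).norm (by simp)).trans ?_
    refine add_le_add ?_ ?_
    · exact (eLpNorm_norm f).le.trans (eLpNorm_mono_measure f hle)
    · rw [hn1]
      exact (eLpNorm_norm _).le
  have hlim : ENNReal.ofReal (u X₀) ≤ ENNReal.ofReal C * (volume Ω ^ (-(1 / q)) * Nq +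
      s * (eLpNorm f ((n : ℝ≥0∞) + 1) (volume.restrict Ω) + 0)) := by
    refine le_of_tendsto_of_tendsto' ((ENNReal.continuous_ofReal.tendsto _).comp
      (hwlim X₀ hX₀Q')) ?_ hj
    have hNlim := tendsto_eLpNorm_max_zero hq0 hQm hQt (fun j => (hw j).continuous) hS
      (fun X hX => hwlim X (hQQ' hX))
    refine ENNReal.Tendsto.const_mul ?_ (Or.inr ENNReal.ofReal_ne_top)
    refine (ENNReal.Tendsto.const_mul hNlim (Or.inr ?_)).add
      (ENNReal.Tendsto.const_mul (tendsto_const_nhds.add hwL) (Or.inr ENNReal.ofReal_ne_top))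
    exact ENNReal.rpow_ne_top_of_ne_zero hV0 hVt
  rw [add_zero] at hlim
  refine hlim.trans ?_
  have hmono : volume Ω ^ (-(1 / q)) * Nq ≤ volume Ω ^ (-(1 / p)) *
      eLpNorm (fun X => max (u X) 0) (ENNReal.ofReal p) (volume.restrict Ω) := by
    have hum : AEStronglyMeasurable (fun X => max (u X) 0) (volume.restrict Ω) :=
      (hcΩ.sup continuousOn_const).aestronglyMeasurable hΩo.measurableSet
    refine le_trans ?_ (rpow_mul_eLpNorm_mono_exponent hq0 hqp hV0 hVt hum)
    gcongr
    exact eLpNorm_mono_measure _ hle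
  gcongr
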